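/- Consider the class of equations $u_t=(D(u)u_x)_x+K(u)u_x$, where the arbitrary elements $D=D(u)$, $K=K(u)$ are smooth functions with $D\neq0$ and $(D_u,K_u)\not\equiv(0,0)$ (nonlinearity). Its equivalence group $G^{\rm equiv}_1$ consists of the local diffeomorphisms of the space of the variables $(t,x,u,D,K)$, $D\ne0$, which act nonsingularly on $(t,x,u)$ and which carry every equation of the class to the equation of the class given by the transformed arbitrary elements; its Lie algebra $A^{\rm equiv}_1$ (the equivalence algebra) consists of the smooth vector fields in $(t,x,u,D,K)$ whose local flows consist of such transformations. Then, on every connected open subset of $\{D\ne0\}$, \[ A^{\rm equiv}_1=\langle \partial_t,\ \partial_x,\ \partial_u,\ u\partial_u,\ t\partial_x-\partial_K,\ 2t\partial_t+x\partial_x-K\partial_K,\ t\partial_t-D\partial_D-K\partial_K\rangle . \] Moreover, the transformations from $G^{\rm equiv}_1$ with connected domain are exactly the local diffeomorphisms with connected domain in $\{D\neq 0\}$ that have the form \[ \tilde t=t\varepsilon_4^2\varepsilon_5+\varepsilon_1,\quad \tilde x=x\varepsilon_4+\varepsilon_7t+\varepsilon_2,\quad \tilde u=u\varepsilon_6+\varepsilon_3,\quad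 \tilde D=D\varepsilon_5^{-1},\quad \tilde K=K\varepsilon_4^{-1}\varepsilon_5^{-1}-\varepsilon_7\varepsilon_4^{-2}\varepsilon_5^{-1}, \] where $\varepsilon_1,\dots,\varepsilon_7$ are arbitrary constants with $\varepsilon_4\varepsilon_5\varepsilon_6\neq0$. -/

import Mathlib

open Filter Topology Set
open scoped ContDiff

/-- The space of the variables `(t, x, u)`. -/
abbrev BaseSpace : Type := Fin 3 → ℝ

/-- The space of the variables `(t, x, u)` extended by the values of the arbitrary elements:
coordinates `0, 1, 2, 3, 4` are `t, x, u, D, K`. -/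
abbrev ExtSpace : Type := Fin 5 → ℝ

/-- The region `D ≠ 0` of the extended space. -/
def diffusiveRegion : Set ExtSpace := {z | z 3 ≠ 0}

/-- The pair of functions `(D, K)` is, near `u₀`, a pair of arbitrary elements of the class
`u_t = (D(u) u_x)_x + K(u) u_x`: both are smooth functions of `u`, `D ≠ 0`, and the equation is
nonlinear near `u₀`, i.e. `(D_u, K_u)` does not vanish identically near `u₀`. -/
structure IsArbitraryElementAt (D K : ℝ → ℝ) (u₀ : ℝ) : Prop where
  smooth_D : ∀ᶠ u in 𝓝 u₀, ContDiffAt ℝ ∞ D u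
  smooth_K : ∀ᶠ u in 𝓝 u₀, ContDiffAt ℝ ∞ K u
  ne_zero : D u₀ ≠ 0
  nonlinear : ¬ ∀ᶠ u in 𝓝 u₀, deriv D u = 0 ∧ deriv K u = 0

/-- The function `w (t, x)` satisfies `w_t = (D(w) w_x)_x + K(w) w_x` at the point `(t, x)`.
For a smooth `w` this is a condition on the 2-jet of `w` at `(t, x)`. -/
def SatisfiesAt (D K : ℝ → ℝ) (w : ℝ → ℝ → ℝ) (t x : ℝ) : Prop :=
  deriv (fun s => w s x) t =
    deriv (fun y => D (w t y) * deriv (w t) y) x + K (w t x) * deriv (w t) x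

/-- The point transformation `φ` of the space `(t, x, u)` carries, over the point `q`, the equation
with the coefficients `(D, K)` to the equation with the coefficients `(D', K')`. Both equations are
regarded as conditions on 2-jets, and the (prolonged) action of `φ` on the jets is the one induced
by its action on graphs of smooth functions: whenever `φ` carries the graph of `w` near `q` to the
graph of `w'`, the 2-jet of `w` at `q` lies on the first equation iff the 2-jet of `w'` at `φ q`
lies on the second one. -/
def CarriesEquationAt (φ : BaseSpace → BaseSpace) (D K D' K' : ℝ → ℝ) (q : BaseSpace) : Prop :=
  ∀ w w' : ℝ → ℝ → ℝ,
    ContDiffAt ℝ ∞ (fun s : ℝ × ℝ => w s.1 s.2) (q 0, q 1) →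
    w (q 0) (q 1) = q 2 →
    ContDiffAt ℝ ∞ (fun s : ℝ × ℝ => w' s.1 s.2) (φ q 0, φ q 1) →
    (∀ᶠ s : ℝ × ℝ in 𝓝 (q 0, q 1),
      w' (φ ![s.1, s.2, w s.1 s.2] 0) (φ ![s.1, s.2, w s.1 s.2] 1) =
        φ ![s.1, s.2, w s.1 s.2] 2) →
    (SatisfiesAt D K w (q 0) (q 1) ↔ SatisfiesAt D' K' w' (φ q 0) (φ q 1))

/-- The point of the extended space over `q = (t, x, u)` given by the arbitrary elements
`D = D(u)`, `K = K(u)`. -/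
def liftPoint (D K : ℝ → ℝ) (q : BaseSpace) : ExtSpace := ![q 0, q 1, q 2, D (q 2), K (q 2)]

/-- The transformation of `(t, x, u)` that a transformation `Φ` of the extended space induces for
fixed arbitrary elements `D = D(u)`, `K = K(u)`. -/
def inducedMap (Φ : ExtSpace → ExtSpace) (D K : ℝ → ℝ) (q : BaseSpace) : BaseSpace :=
  ![Φ (liftPoint D K q) 0, Φ (liftPoint D K q) 1, Φ (liftPoint D K q) 2]

/-- A map of the space `(t, x, u)` is nonsingular at `q`. -/
def NonsingularAt (φ : BaseSpace → BaseSpace) (q : BaseSpace) : Prop :=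
  Function.Bijective (fderiv ℝ φ q)

/-- `Φ` is a local equivalence transformation of the class `u_t = (D(u) u_x)_x + K(u) u_x`: a local
diffeomorphism of the space `(t, x, u, D, K)` (the new `t, x, u` may depend on `D, K` as well) that
preserves the form of the equations of the class. -/
structure IsEquivalenceTransformation (Φ : OpenPartialHomeomorph ExtSpace ExtSpace) : Prop where
  source_subset : Φ.source ⊆ diffusiveRegion
  smooth : ContDiffOn ℝ ∞ Φ Φ.source
  smooth_symm : ContDiffOn ℝ ∞ Φ.symm Φ.target
  /-- At every point `Φ` acts nonsingularly on `(t, x, u)` for some arbitrary elements. -/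
  nondegenerate : ∀ z ∈ Φ.source, ∃ (D K : ℝ → ℝ) (q : BaseSpace),
    IsArbitraryElementAt D K (q 2) ∧ liftPoint D K q = z ∧ NonsingularAt (inducedMap Φ D K) q
  /-- Whenever the induced transformation of `(t, x, u)` is nonsingular at `q₀`, the transformed
  arbitrary elements are arbitrary elements of the class again, in particular functions of the new
  `u` only, and the equation is carried to the one with the transformed arbitrary elements. -/
  preserves : ∀ (D K : ℝ → ℝ) (q₀ : BaseSpace),
    IsArbitraryElementAt D K (q₀ 2) → liftPoint D K q₀ ∈ Φ.source →
    NonsingularAt (inducedMap Φ D K) q₀ →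
    ∃ D' K' : ℝ → ℝ, IsArbitraryElementAt D' K' (inducedMap Φ D K q₀ 2) ∧
      ∀ᶠ q in 𝓝 q₀,
        Φ (liftPoint D K q) 3 = D' (inducedMap Φ D K q 2) ∧
        Φ (liftPoint D K q) 4 = K' (inducedMap Φ D K q 2) ∧
        CarriesEquationAt (inducedMap Φ D K) D K D' K' q

/-- The vector field `V` on the open set `Ω` belongs to the Lie algebra of the equivalence
(pseudo)group: it is smooth and its local flow consists of equivalence transformations. -/
structure IsEquivalenceOperatorOn (Ω : Set ExtSpace) (V : ExtSpace → ExtSpace) : Prop where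
  smooth : ContDiffOn ℝ ∞ V Ω
  flow : ∀ z₀ ∈ Ω, ∃ δ > (0 : ℝ), ∃ N : Set ExtSpace, IsOpen N ∧ z₀ ∈ N ∧
    ∃ F : ℝ → ExtSpace → ExtSpace,
      (∀ z ∈ N, F 0 z = z) ∧
      (∀ s ∈ Ioo (-δ) δ, ∀ z ∈ N,
        F s z ∈ Ω ∧ HasDerivAt (fun r => F r z) (V (F s z)) s) ∧
      ∀ s ∈ Ioo (-δ) δ, ∃ Φ : OpenPartialHomeomorph ExtSpace ExtSpace,
        IsEquivalenceTransformation Φ ∧ Φ.source = N ∧ EqOn Φ (F s) N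

/-- The span of `∂_t`, `∂_x`, `∂_u`, `u∂_u`, `t∂_x - ∂_K`, `2t∂_t + x∂_x - K∂_K` and
`t∂_t - D∂_D - K∂_K`. -/
def equivalenceSpan : Submodule ℝ (ExtSpace → ExtSpace) :=
  Submodule.span ℝ
    {fun _ => ![1, 0, 0, 0, 0],
     fun _ => ![0, 1, 0, 0, 0],
     fun _ => ![0, 0, 1, 0, 0],
     fun z => ![0, 0, z 2, 0, 0],
     fun z => ![0, z 0, 0, 0, -1],
     fun z => ![2 * z 0, z 1, 0, 0, -z 4],
     fun z => ![z 0, 0, 0, -z 3, -z 4]}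

/-! Write `T, X, U, D̃, K̃` for the components of a transformation. At a point `z` of its domain,
take quadratic coefficients `D`, `K` through `z` with freely chosen first derivatives `a ≠ 0`, `b`
(in an open set) and second derivatives `c`, `e`, together with a quadratic polynomial `w` whose
2-jet lies on the equation. Its graph is carried to the graph of some `w'`, and the 2-jet of `w'`
must lie on the transformed equation. `CarriesEquationAt.transformed_jet` and
`IsEquivalenceTransformation.exists_jet_condition` turn this into an algebraic identity in `w_tt`,
`w_xx`, `w_x`, which is then split.

The coefficient of `w_tt` gives `T = T(t)`. The coefficient of `w_xx` gives `X = X(t, x)` and `D̃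
T_t = D X_x²`. The coefficient of `w_x²`, with `c` and `e` free, shows that `U` does not depend on
`D`, `K` and that its second total derivative along the coefficients vanishes. Since `D̃` and `K̃`
restricted to given coefficients are functions of `U` alone, varying the slope `a` forces `U_t = U_x
= 0`, hence `D̃` and `K̃` do not depend on `t`, `x` either. Now the coefficient of `w_x` gives `K̃
T_t = K X_x - X_t`. Differentiating the rules for `D̃` and `K̃` in `t` and `x` kills the remaining
second derivatives, so `T`, `X`, `U` are affine and the seven-parameter form follows locally
(`IsRegularBox.eq_equivalenceMap`). The family is analytic, so connectedness makes the parameters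
global.

Conversely, the family consists of equivalence transformations by the chain rule. For the algebra, a
flow lies in the family for small times; its parameters are recovered from difference quotients and
so are differentiable at time zero, which places the generator in the span. In the other direction,
the fields of the span are integrated explicitly within the family. -/

/-! ### Second derivatives along curves and the expanded equation -/

/-- The second derivative of a function along a curve. -/
theorem deriv_deriv_comp_curve {E F : Type*} [NormedAddCommGroup E] [NormedSpace ℝ E]
    [NormedAddCommGroup F] [NormedSpace ℝ F] {f : E → F} {γ : ℝ → E} {s : ℝ}
    (hf : ContDiffAt ℝ 2 f (γ s)) (hγ : ContDiffAt ℝ 2 γ s) :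
    deriv (deriv fun y => f (γ y)) s =
      fderiv ℝ (fderiv ℝ f) (γ s) (deriv γ s) (deriv γ s) +
        fderiv ℝ f (γ s) (deriv (deriv γ) s) := by
  have hf' : ∀ᶠ y in 𝓝 s, ContDiffAt ℝ 2 f (γ y) :=
    hγ.continuousAt.eventually (hf.eventually (by simp))
  have hγ' : ∀ᶠ y in 𝓝 s, ContDiffAt ℝ 2 γ y := hγ.eventually (by simp)
  have h1 : deriv (fun y => f (γ y)) =ᶠ[𝓝 s] fun y => fderiv ℝ f (γ y) (deriv γ y) := by
    filter_upwards [hf', hγ'] with y h1 h2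
    exact ((h1.differentiableAt (by simp)).hasFDerivAt.comp_hasDerivAt y
      (h2.differentiableAt (by simp)).hasDerivAt).deriv
  rw [h1.deriv_eq]
  have h2 : DifferentiableAt ℝ (fderiv ℝ f) (γ s) :=
    (hf.fderiv_right (m := 1) (by norm_num)).differentiableAt (by simp)
  have h3 : DifferentiableAt ℝ (deriv γ) s :=
    (hγ.derivWithin (m := 1) (by norm_num)).differentiableAt (by simp)
  have h4 := h2.hasFDerivAt.comp_hasDerivAt s (hγ.differentiableAt (by simp)).hasDerivAt
  exact (h4.clm_apply h3.hasDerivAt).deriv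

theorem deriv_deriv_clm_comp {E F : Type*} [NormedAddCommGroup E] [NormedSpace ℝ E]
    [NormedAddCommGroup F] [NormedSpace ℝ F] (l : E →L[ℝ] F) {γ : ℝ → E} {s : ℝ}
    (hγ : ContDiffAt ℝ 2 γ s) :
    deriv (deriv fun y => l (γ y)) s = l (deriv (deriv γ) s) := by
  have h : fderiv ℝ (l : E → F) = fun _ => l := funext fun x => l.fderiv
  rw [deriv_deriv_comp_curve l.contDiff.contDiffAt hγ, h]
  simp

theorem satisfiesAt_iff {D K : ℝ → ℝ} {w : ℝ → ℝ → ℝ} {t x : ℝ}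
    (hw : ContDiffAt ℝ 2 (w t) x) (hD : DifferentiableAt ℝ D (w t x)) :
    SatisfiesAt D K w t x ↔ deriv (fun s => w s x) t =
      D (w t x) * deriv (deriv (w t)) x + deriv D (w t x) * deriv (w t) x ^ 2 +
        K (w t x) * deriv (w t) x := by
  have h3 : DifferentiableAt ℝ (deriv (w t)) x :=
    (hw.derivWithin (m := 1) (by norm_num)).differentiableAt (by simp)
  have h1 : HasDerivAt (fun y => D (w t y)) (deriv D (w t x) * deriv (w t) x) x :=
    hD.hasDerivAt.comp x (hw.differentiableAt (by simp)).hasDerivAt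
  unfold SatisfiesAt
  rw [(h1.fun_mul h3.hasDerivAt).deriv]
  constructor <;> intro h <;> rw [h] <;> ring

/-! ### Quadratic test coefficients and lifted parabolas -/

/-- The quadratic polynomial with value `d` and derivatives `a`, `c` at `u₀`. -/
noncomputable def quadratic (d a c u₀ : ℝ) : ℝ → ℝ :=
  fun v => d + a * (v - u₀) + c / 2 * (v - u₀) ^ 2

theorem quadratic_self (d a c u₀ : ℝ) : quadratic d a c u₀ u₀ = d := by simp [quadratic]

theorem contDiff_quadratic (d a c u₀ : ℝ) : ContDiff ℝ ∞ (quadratic d a c u₀) := by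
  unfold quadratic; fun_prop

theorem hasDerivAt_quadratic (d a c u₀ v : ℝ) :
    HasDerivAt (quadratic d a c u₀) (a + c * (v - u₀)) v := by
  have h : HasDerivAt (fun v : ℝ => v - u₀) 1 v := (hasDerivAt_id v).sub_const u₀
  exact (((h.const_mul a).const_add d).add ((h.pow 2).const_mul (c / 2))).congr_deriv
    (by simp; ring)

theorem liftPoint_quadratic (z : ExtSpace) (a b c e : ℝ) :
    liftPoint (quadratic (z 3) a c (z 2)) (quadratic (z 4) b e (z 2)) ![z 0, z 1, z 2] = z := by
  ext i
  fin_cases i <;> simp [liftPoint, quadratic_self]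

/-- The curve over a parabola in the graph of a quadratic polynomial. -/
noncomputable def liftedCurve (z : ExtSpace) (a b c e ξ η u₁ ρ : ℝ) (y : ℝ) : ExtSpace :=
  ![z 0 + y * ξ, z 1 + y * η, quadratic (z 2) u₁ ρ 0 y,
    quadratic (z 3) a c (z 2) (quadratic (z 2) u₁ ρ 0 y),
    quadratic (z 4) b e (z 2) (quadratic (z 2) u₁ ρ 0 y)]

theorem liftedCurve_zero (z : ExtSpace) (a b c e ξ η u₁ ρ : ℝ) :
    liftedCurve z a b c e ξ η u₁ ρ 0 = z := by
  ext i
  fin_cases i <;> simp [liftedCurve, quadratic_self]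

theorem contDiff_liftedCurve (z : ExtSpace) (a b c e ξ η u₁ ρ : ℝ) :
    ContDiff ℝ ∞ (liftedCurve z a b c e ξ η u₁ ρ) := by
  rw [contDiff_pi]
  intro i
  fin_cases i <;> simp [liftedCurve, quadratic] <;> fun_prop

theorem deriv_liftedCurve (z : ExtSpace) (a b c e ξ η u₁ ρ y : ℝ) :
    deriv (liftedCurve z a b c e ξ η u₁ ρ) y =
      ![ξ, η, u₁ + ρ * y, (a + c * (quadratic (z 2) u₁ ρ 0 y - z 2)) * (u₁ + ρ * y),
        (b + e * (quadratic (z 2) u₁ ρ 0 y - z 2)) * (u₁ + ρ * y)] := by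
  have h : HasDerivAt (quadratic (z 2) u₁ ρ 0) (u₁ + ρ * y) y := by
    simpa using hasDerivAt_quadratic (z 2) u₁ ρ 0 y
  refine HasDerivAt.deriv (hasDerivAt_pi.2 fun i => ?_)
  fin_cases i <;> simp only [liftedCurve]
  · simpa using ((hasDerivAt_id y).mul_const ξ).const_add (z 0)
  · simpa using ((hasDerivAt_id y).mul_const η).const_add (z 1)
  · exact h
  · exact (hasDerivAt_quadratic (z 3) a c (z 2) _).comp y h
  · exact (hasDerivAt_quadratic (z 4) b e (z 2) _).comp y h

theorem deriv_liftedCurve_zero (z : ExtSpace) (a b c e ξ η u₁ ρ : ℝ) :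
    deriv (liftedCurve z a b c e ξ η u₁ ρ) 0 = ![ξ, η, u₁, a * u₁, b * u₁] := by
  rw [deriv_liftedCurve]; simp [quadratic_self]

theorem deriv_deriv_liftedCurve_zero (z : ExtSpace) (a b c e ξ η u₁ ρ : ℝ) :
    deriv (deriv (liftedCurve z a b c e ξ η u₁ ρ)) 0 =
      ![0, 0, ρ, c * u₁ ^ 2 + a * ρ, e * u₁ ^ 2 + b * ρ] := by
  have h0 : HasDerivAt (fun y => quadratic (z 2) u₁ ρ 0 y - z 2) u₁ 0 := by
    simpa using (hasDerivAt_quadratic (z 2) u₁ ρ 0 0).sub_const (z 2)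
  have h1 : HasDerivAt (fun y => u₁ + ρ * y) ρ 0 := by
    simpa using ((hasDerivAt_id (0 : ℝ)).const_mul ρ).const_add u₁
  have h2 (a c : ℝ) : HasDerivAt
      (fun y => (a + c * (quadratic (z 2) u₁ ρ 0 y - z 2)) * (u₁ + ρ * y))
      (c * u₁ ^ 2 + a * ρ) 0 := by
    exact (((h0.const_mul c).const_add a).mul h1).congr_deriv (by simp [quadratic_self]; ring)
  rw [funext (deriv_liftedCurve z a b c e ξ η u₁ ρ)]
  refine HasDerivAt.deriv (hasDerivAt_pi.2 fun i => ?_)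
  fin_cases i
  · exact hasDerivAt_const _ _
  · exact hasDerivAt_const _ _
  · exact h1
  · exact h2 a c
  · exact h2 b e

/-! ### Transport of 2-jets by a transformation of the extended space -/

/-- A locally defined function on the plane whose graph is a given smooth parametrized surface that
is transversal to the fibres. -/
theorem exists_graph_of_det_ne_zero {A : ℝ × ℝ → ℝ × ℝ} {B : ℝ × ℝ → ℝ} {s₀ : ℝ × ℝ}
    (hA : ContDiffAt ℝ ∞ A s₀) (hB : ContDiffAt ℝ ∞ B s₀)
    (hdet : (fderiv ℝ A s₀ (1, 0)).1 * (fderiv ℝ A s₀ (0, 1)).2 -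
      (fderiv ℝ A s₀ (0, 1)).1 * (fderiv ℝ A s₀ (1, 0)).2 ≠ 0) :
    ∃ w : ℝ → ℝ → ℝ, ContDiffAt ℝ ∞ (fun s : ℝ × ℝ => w s.1 s.2) (A s₀) ∧
      ∀ᶠ s in 𝓝 s₀, w (A s).1 (A s).2 = B s := by
  have hinj : Function.Injective (fderiv ℝ A s₀ : ℝ × ℝ →ₗ[ℝ] ℝ × ℝ) := by
    rw [← LinearMap.ker_eq_bot, LinearMap.ker_eq_bot']
    intro v hv
    have hv' : fderiv ℝ A s₀ v = v.1 • fderiv ℝ A s₀ (1, 0) + v.2 • fderiv ℝ A s₀ (0, 1) := by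
      rw [← map_smul, ← map_smul, ← map_add]; simp
    rw [ContinuousLinearMap.coe_coe, hv'] at hv
    have h1 := congrArg Prod.fst hv
    have h2 := congrArg Prod.snd hv
    simp only [Prod.fst_add, Prod.snd_add, Prod.smul_fst, Prod.smul_snd, smul_eq_mul,
      Prod.fst_zero, Prod.snd_zero] at h1 h2
    refine Prod.ext (mul_right_cancel₀ hdet ?_) (mul_right_cancel₀ hdet ?_)
    · simp only [Prod.fst_zero]; linear_combination
        (fderiv ℝ A s₀ (0, 1)).2 * h1 - (fderiv ℝ A s₀ (0, 1)).1 * h2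
    · simp only [Prod.snd_zero]; linear_combination
        (fderiv ℝ A s₀ (1, 0)).1 * h2 - (fderiv ℝ A s₀ (1, 0)).2 * h1
  let f' : (ℝ × ℝ) ≃L[ℝ] ℝ × ℝ := (LinearEquiv.ofInjectiveEndo _ hinj).toContinuousLinearEquiv
  have hf' : (f' : ℝ × ℝ →L[ℝ] ℝ × ℝ) = fderiv ℝ A s₀ := by ext <;> rfl
  have hA' : HasFDerivAt A (f' : ℝ × ℝ →L[ℝ] ℝ × ℝ) s₀ := by
    rw [hf']; exact (hA.differentiableAt (by simp)).hasFDerivAt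
  have hinv := (hA.hasStrictFDerivAt' hA' (by simp)).eventually_left_inverse
  have hg := hA.to_localInverse hA' (by simp)
  refine ⟨fun t x => B (hA.localInverse hA' (by simp) (t, x)), ?_, ?_⟩
  · have : hA.localInverse hA' (by simp) (A s₀) = s₀ := hinv.self_of_nhds
    exact ContDiffAt.comp (A s₀) (by rw [this]; exact hB) hg
  · filter_upwards [hinv] with s hs
    exact congrArg B hs

theorem two_le_smooth : (2 : ℕ∞ω) ≤ ∞ := by
  change ((2 : ℕ∞) : ℕ∞ω) ≤ ∞
  exact WithTop.coe_le_coe.2 le_top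

/-- The condition that a transformation of the extended space carries an equation with quadratic
arbitrary elements to another equation, evaluated on the 2-jet of a solution.
Here `ωt`, `ωx` are the first derivatives of the transformed function and `(ξ, η)` is the vector
that is carried to the unit vector of the new `x`-axis. -/
theorem CarriesEquationAt.transformed_jet {Φ : ExtSpace → ExtSpace} {z : ExtSpace}
    (hΦ : ContDiffAt ℝ ∞ Φ z) {a b c e : ℝ} {D' K' : ℝ → ℝ}
    (hD' : DifferentiableAt ℝ D' (Φ z 2))
    (hc : CarriesEquationAt
      (inducedMap Φ (quadratic (z 3) a c (z 2)) (quadratic (z 4) b e (z 2)))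
      (quadratic (z 3) a c (z 2)) (quadratic (z 4) b e (z 2)) D' K' ![z 0, z 1, z 2])
    {τ p m r ξ η ωt ωx u₁ ρ : ℝ} (hE : τ = z 3 * r + a * p ^ 2 + z 4 * p)
    {A₀ A₁ S : ExtSpace} (hA₀ : fderiv ℝ Φ z ![1, 0, τ, a * τ, b * τ] = A₀)
    (hA₁ : fderiv ℝ Φ z ![0, 1, p, a * p, b * p] = A₁)
    (hdet : A₀ 0 * A₁ 1 - A₁ 0 * A₀ 1 ≠ 0)
    (hω₀ : ωt * A₀ 0 + ωx * A₀ 1 = A₀ 2) (hω₁ : ωt * A₁ 0 + ωx * A₁ 1 = A₁ 2)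
    (hξ : ξ * A₀ 0 + η * A₁ 0 = 0) (hη : ξ * A₀ 1 + η * A₁ 1 = 1)
    (hu₁ : u₁ = τ * ξ + p * η) (hρ : ρ = m * ξ ^ 2 + r * η ^ 2)
    (hS : S = fderiv ℝ (fderiv ℝ Φ) z ![ξ, η, u₁, a * u₁, b * u₁] ![ξ, η, u₁, a * u₁, b * u₁] +
      fderiv ℝ Φ z ![0, 0, ρ, c * u₁ ^ 2 + a * ρ, e * u₁ ^ 2 + b * ρ]) :
    ωt = D' (Φ z 2) * (S 2 - ωt * S 0 - ωx * S 1) + deriv D' (Φ z 2) * ωx ^ 2 +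
      K' (Φ z 2) * ωx := by
  set D := quadratic (z 3) a c (z 2) with hD
  set K := quadratic (z 4) b e (z 2) with hK
  -- The test function has `w_t = τ`, `w_x = p`, `w_tt = m`, `w_xx = r`. The equation does not
  -- involve `w_tx`, which is taken to be zero; this is why `ρ` has no mixed term.
  let w : ℝ → ℝ → ℝ := fun t x => z 2 + τ * (t - z 0) + p * (x - z 1) +
    m / 2 * (t - z 0) ^ 2 + r / 2 * (x - z 1) ^ 2
  let s₀ : ℝ × ℝ := (z 0, z 1)
  let G : ℝ × ℝ → ExtSpace := fun s => liftPoint D K ![s.1, s.2, w s.1 s.2]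
  have hw : ContDiff ℝ ∞ fun s : ℝ × ℝ => w s.1 s.2 := by
    simp only [w]; fun_prop
  have hw0 : w (z 0) (z 1) = z 2 := by simp [w]
  have hG : ContDiff ℝ ∞ G := by
    rw [contDiff_pi]
    intro i
    fin_cases i <;> simp [G, liftPoint, D, K, quadratic, w] <;> fun_prop
  have hG0 : G s₀ = z := by
    simp only [G, s₀, hw0]; exact liftPoint_quadratic z a b c e
  have hcurve (v₁ v₂ : ℝ) : (fun y : ℝ => G (s₀ + y • (v₁, v₂))) =
      liftedCurve z a b c e v₁ v₂ (τ * v₁ + p * v₂) (m * v₁ ^ 2 + r * v₂ ^ 2) := by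
    have hwy (y : ℝ) : w (z 0 + y * v₁) (z 1 + y * v₂) =
        quadratic (z 2) (τ * v₁ + p * v₂) (m * v₁ ^ 2 + r * v₂ ^ 2) 0 y := by
      simp only [w, quadratic]; ring
    funext y i
    fin_cases i <;> simp [G, liftPoint, liftedCurve, s₀, hwy, D, K]
  have hline (v : ℝ × ℝ) : HasDerivAt (fun y : ℝ => s₀ + y • v) v 0 := by
    simpa using ((hasDerivAt_id (0 : ℝ)).smul_const v).const_add s₀
  have hΦG : ContDiffAt ℝ ∞ Φ (G s₀) := by rw [hG0]; exact hΦ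
  have hB : ContDiffAt ℝ ∞ (fun s => Φ (G s)) s₀ := hΦG.comp s₀ hG.contDiffAt
  have hB' (v₁ v₂ : ℝ) : fderiv ℝ (fun s => Φ (G s)) s₀ (v₁, v₂) = fderiv ℝ Φ z
      ![v₁, v₂, τ * v₁ + p * v₂, a * (τ * v₁ + p * v₂), b * (τ * v₁ + p * v₂)] := by
    have h1 : HasFDerivAt (fun s => Φ (G s)) (fderiv ℝ (fun s => Φ (G s)) s₀)
        (s₀ + (0 : ℝ) • (v₁, v₂)) := by
      simpa using (hB.differentiableAt (by simp)).hasFDerivAt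
    have h2 := h1.comp_hasDerivAt (0 : ℝ) (hline (v₁, v₂))
    have h3 : HasDerivAt (fun y : ℝ => G (s₀ + y • (v₁, v₂)))
        (deriv (liftedCurve z a b c e v₁ v₂ (τ * v₁ + p * v₂) (m * v₁ ^ 2 + r * v₂ ^ 2)) 0) 0 := by
      rw [hcurve]
      exact ((contDiff_liftedCurve _ _ _ _ _ _ _ _ _).differentiable (by simp) 0).hasDerivAt
    have h4 : HasFDerivAt Φ (fderiv ℝ Φ z) (G (s₀ + (0 : ℝ) • (v₁, v₂))) := by
      simpa [hG0] using (hΦ.differentiableAt (by simp)).hasFDerivAt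
    have h5 := h4.comp_hasDerivAt (0 : ℝ) h3
    rw [deriv_liftedCurve_zero] at h5
    exact h2.unique h5
  have hcomp (i : Fin 5) : HasFDerivAt (fun s => Φ (G s) i) ((ContinuousLinearMap.proj i).comp
      (fderiv ℝ (fun s => Φ (G s)) s₀) : ℝ × ℝ →L[ℝ] ℝ) s₀ :=
    hasFDerivAt_pi'.1 (hB.differentiableAt (by simp)).hasFDerivAt i
  have hcomp' (i : Fin 5) : ContDiffAt ℝ ∞ (fun s => Φ (G s) i) s₀ := contDiffAt_pi.1 hB i
  have hBt : fderiv ℝ (fun s => Φ (G s)) s₀ (1, 0) = A₀ := by rw [hB', ← hA₀]; simp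
  have hBx : fderiv ℝ (fun s => Φ (G s)) s₀ (0, 1) = A₁ := by rw [hB', ← hA₁]; simp
  have hA' := (hcomp 0).prodMk (hcomp 1)
  obtain ⟨w', hw', hgraph⟩ := exists_graph_of_det_ne_zero
    (A := fun s => (Φ (G s) 0, Φ (G s) 1)) (B := fun s => Φ (G s) 2)
    ((hcomp' 0).prodMk (hcomp' 1)) (hcomp' 2) (by
      rw [hA'.fderiv]; simpa [hBt, hBx] using hdet)
  simp only [hG0] at hw'
  have hsat : SatisfiesAt D K w (z 0) (z 1) := by
    have h1 : deriv (fun s => w s (z 1)) (z 0) = τ := by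
      have : (fun s => w s (z 1)) = quadratic (z 2) τ m (z 0) := by
        funext s; simp [w, quadratic]
      rw [this, (hasDerivAt_quadratic _ _ _ _ _).deriv]; simp
    have h2 : w (z 0) = quadratic (z 2) p r (z 1) := by
      funext s; simp [w, quadratic]
    have h3 : deriv (quadratic (z 2) p r (z 1)) = fun y => p + r * (y - z 1) :=
      funext fun y => (hasDerivAt_quadratic _ _ _ _ _).deriv
    have h4 : deriv (fun y => p + r * (y - z 1)) (z 1) = r := by
      simp
    have h5 : ContDiffAt ℝ 2 (w (z 0)) (z 1) := by
      rw [h2]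
      exact (contDiff_quadratic _ _ _ _).contDiffAt.of_le two_le_smooth
    rw [satisfiesAt_iff h5 (hasDerivAt_quadratic _ _ _ _ _).differentiableAt, h1, h2, h3, h4,
      quadratic_self, (hasDerivAt_quadratic _ _ _ _ _).deriv, quadratic_self, hK, quadratic_self]
    simpa using hE
  have hΦ0 : liftPoint D K ![z 0, z 1, z 2] = z := liftPoint_quadratic z a b c e
  have hsat' : SatisfiesAt D' K' w' (Φ z 0) (Φ z 1) := by
    have h := (hc w w' hw.contDiffAt hw0 (by simpa [inducedMap, hΦ0] using hw')
      (by simpa [inducedMap] using hgraph)).1 hsat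
    simpa [inducedMap, hΦ0] using h
  let W : ℝ × ℝ → ℝ := fun s => w' s.1 s.2
  set T := Φ z 0
  set X := Φ z 1
  have hWd : HasFDerivAt W (fderiv ℝ W (T, X)) (T, X) :=
    (hw'.differentiableAt (by simp)).hasFDerivAt
  have hγ : HasDerivAt (fun y : ℝ => (T, y)) ((0 : ℝ), (1 : ℝ)) X :=
    (hasDerivAt_const X T).prodMk (hasDerivAt_id X)
  have hγ' : deriv (fun y : ℝ => (T, y)) = fun _ => ((0 : ℝ), (1 : ℝ)) :=
    funext fun y => ((hasDerivAt_const y T).prodMk (hasDerivAt_id y)).deriv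
  have hdt : deriv (fun s => w' s X) T = fderiv ℝ W (T, X) (1, 0) :=
    (hWd.comp_hasDerivAt (f := fun s => (s, X)) T
      ((hasDerivAt_id T).prodMk (hasDerivAt_const T X))).deriv
  have hdx : deriv (w' T) X = fderiv ℝ W (T, X) (0, 1) := (hWd.comp_hasDerivAt X hγ).deriv
  have hdxx : deriv (deriv (w' T)) X = fderiv ℝ (fderiv ℝ W) (T, X) (0, 1) (0, 1) := by
    have := deriv_deriv_comp_curve (f := W) (γ := fun y : ℝ => (T, y)) (s := X)
      (hw'.of_le two_le_smooth) (by fun_prop)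
    rw [hγ'] at this
    simpa using this
  have hwT : w' T X = Φ z 2 := by
    have := hgraph.self_of_nhds
    simpa only [hG0] using this
  have hwT' : ContDiffAt ℝ 2 (w' T) X :=
    ContDiffAt.comp (g := W) (f := fun y : ℝ => (T, y)) X (hw'.of_le two_le_smooth)
      (by fun_prop)
  rw [satisfiesAt_iff hwT' (by rw [hwT]; exact hD'), hdt, hdx, hdxx, hwT] at hsat'
  have hlin (α β : ℝ) : fderiv ℝ W (T, X) (α, β) =
      α * fderiv ℝ W (T, X) (1, 0) + β * fderiv ℝ W (T, X) (0, 1) := by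
    have : ((α, β) : ℝ × ℝ) = α • (1, 0) + β • (0, 1) := by simp
    rw [this, map_add, map_smul, map_smul]; rfl
  -- Differentiating the graph relation once gives a linear system for the gradient of `w'`. By
  -- `hdet` its solution is unique, so it is `(ωt, ωx)`.
  have hchain (v : ℝ × ℝ) : fderiv ℝ W (T, X) (fderiv ℝ (fun s => Φ (G s)) s₀ v 0,
      fderiv ℝ (fun s => Φ (G s)) s₀ v 1) = fderiv ℝ (fun s => Φ (G s)) s₀ v 2 := by
    have h1 : HasFDerivAt W (fderiv ℝ W (T, X)) (Φ (G s₀) 0, Φ (G s₀) 1) := by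
      rw [hG0]; exact hWd
    have h2 := h1.comp s₀ hA'
    exact congrArg (fun l => l v) (h2.unique ((hcomp 2).congr_of_eventuallyEq hgraph))
  have hc₀ := hchain (1, 0)
  have hc₁ := hchain (0, 1)
  rw [hBt, hlin] at hc₀
  rw [hBx, hlin] at hc₁
  have hωt : fderiv ℝ W (T, X) (1, 0) = ωt := mul_right_cancel₀ hdet (by
    linear_combination A₁ 1 * hc₀ - A₀ 1 * hc₁ - A₁ 1 * hω₀ + A₀ 1 * hω₁)
  have hωx : fderiv ℝ W (T, X) (0, 1) = ωx := mul_right_cancel₀ hdet (by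
    linear_combination A₀ 0 * hc₁ - A₁ 0 * hc₀ - A₀ 0 * hω₁ + A₁ 0 * hω₀)
  -- The image of the graph over the line with direction `(ξ, η)`. Its projection to the new `(t,
  -- x)` starts with velocity `(0, 1)`, so second derivatives along it see the new `x`-derivative
  -- only.
  let ψ : ℝ → ExtSpace := fun y => Φ (liftedCurve z a b c e ξ η u₁ ρ y)
  have hΦL : ContDiffAt ℝ ∞ Φ (liftedCurve z a b c e ξ η u₁ ρ 0) := by
    rw [liftedCurve_zero]; exact hΦ
  have hL2 : ContDiffAt ℝ 2 (liftedCurve z a b c e ξ η u₁ ρ) 0 :=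
    (contDiff_liftedCurve _ _ _ _ _ _ _ _ _).contDiffAt.of_le two_le_smooth
  have hΦL2 : ContDiffAt ℝ 2 Φ (liftedCurve z a b c e ξ η u₁ ρ 0) :=
    hΦL.of_le two_le_smooth
  have hψ : ContDiffAt ℝ 2 ψ 0 := hΦL2.comp 0 hL2
  have hψS : deriv (deriv ψ) 0 = S := by
    rw [deriv_deriv_comp_curve hΦL2 hL2, deriv_deriv_liftedCurve_zero, deriv_liftedCurve_zero,
      liftedCurve_zero, hS]
  have hψeq : ψ = fun y : ℝ => Φ (G (s₀ + y • (ξ, η))) := by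
    simp only [ψ, hu₁, hρ, ← hcurve]
  have hψ1 : deriv ψ 0 = ξ • A₀ + η • A₁ := by
    have h1 : HasFDerivAt (fun s => Φ (G s)) (fderiv ℝ (fun s => Φ (G s)) s₀)
        (s₀ + (0 : ℝ) • (ξ, η)) := by
      simpa using (hB.differentiableAt (by simp)).hasFDerivAt
    rw [hψeq, ← hBt, ← hBx, ← map_smul, ← map_smul, ← map_add]
    simpa using! (h1.comp_hasDerivAt (0 : ℝ) (hline (ξ, η))).deriv
  let π : ExtSpace →L[ℝ] ℝ × ℝ :=
    (ContinuousLinearMap.proj 0).prod (ContinuousLinearMap.proj 1)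
  have hψev : (fun y => W (π (ψ y))) =ᶠ[𝓝 0] fun y => ψ y 2 := by
    have : Tendsto (fun y : ℝ => s₀ + y • (ξ, η)) (𝓝 0) (𝓝 s₀) := by
      simpa using (hline (ξ, η)).continuousAt.tendsto
    rw [hψeq]
    exact this.eventually hgraph
  have hπψ : ContDiffAt ℝ 2 (fun y => π (ψ y)) 0 := π.contDiff.contDiffAt.comp 0 hψ
  have hπ0 : π (ψ 0) = (T, X) := by simp [π, ψ, liftedCurve_zero, T, X]
  have hπ1 : deriv (fun y => π (ψ y)) 0 = (0, 1) := by
    have := (π.hasFDerivAt.comp_hasDerivAt (0 : ℝ)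
      (hψ.differentiableAt (by simp)).hasDerivAt).deriv
    simp only [Function.comp_def] at this
    rw [this, hψ1]
    simp [π, hξ, hη]
  -- The second derivative of `w'` along the projected curve is `w'_xx` plus the gradient applied to
  -- the acceleration `(S 0, S 1)`; it equals `S 2`. This expresses `w'_xx` as `S 2 - ωt * S 0 - ωx
  -- * S 1`.
  have h2 := deriv_deriv_comp_curve (f := W) (γ := fun y => π (ψ y)) (s := 0)
    (by rw [hπ0]; exact hw'.of_le two_le_smooth) hπψ
  rw [hψev.deriv.deriv_eq, hπ1, deriv_deriv_clm_comp π hψ, hψS, hπ0] at h2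
  have h3 := deriv_deriv_clm_comp (ContinuousLinearMap.proj (R := ℝ) (φ := fun _ : Fin 5 => ℝ) 2) hψ
  simp only [ContinuousLinearMap.proj_apply] at h3
  rw [h3, hψS] at h2
  have h4 : π S = (S 0, S 1) := rfl
  rw [h4, hlin] at h2
  rw [hωt, hωx] at h2 hsat'
  linear_combination hsat' - D' (Φ z 2) * h2

/-! ### Splitting the jet condition: new time and new space variable -/

/-- The linear algebra behind the form of the new `t`: if the prolonged action on 2-jets of a
transformation of `(t, x, u)` with the partial derivatives `P₀`, `P₁`, `Q` carries an evolution
equation to an evolution equation, the new `t` depends on `t` only. -/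
theorem time_of_jet_condition {P₀ P₁ Q : ExtSpace} {d a k f δ g : ℝ} {H : ℝ → ℝ → ℝ → ExtSpace}
    (hd : d ≠ 0) (hf : f ≠ 0)
    (hjac : P₀ 0 * (P₁ 1 * Q 2 - Q 1 * P₁ 2) - P₁ 0 * (P₀ 1 * Q 2 - Q 1 * P₀ 2) +
      Q 0 * (P₀ 1 * P₁ 2 - P₁ 1 * P₀ 2) ≠ 0)
    (hJ : ∀ τ p m r ξ η ωt ωx : ℝ, τ = d * r + a * p ^ 2 + k * p →
      (P₀ 0 + τ * Q 0) * (P₁ 1 + p * Q 1) - (P₁ 0 + p * Q 0) * (P₀ 1 + τ * Q 1) ≠ 0 →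
      ωt * (P₀ 0 + τ * Q 0) + ωx * (P₀ 1 + τ * Q 1) = P₀ 2 + τ * Q 2 →
      ωt * (P₁ 0 + p * Q 0) + ωx * (P₁ 1 + p * Q 1) = P₁ 2 + p * Q 2 →
      ξ * (P₀ 0 + τ * Q 0) + η * (P₁ 0 + p * Q 0) = 0 →
      ξ * (P₀ 1 + τ * Q 1) + η * (P₁ 1 + p * Q 1) = 1 →
      ωt = f * ((H ξ η (τ * ξ + p * η) 2 + (m * ξ ^ 2 + r * η ^ 2) * Q 2) -
          ωt * (H ξ η (τ * ξ + p * η) 0 + (m * ξ ^ 2 + r * η ^ 2) * Q 0) -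
          ωx * (H ξ η (τ * ξ + p * η) 1 + (m * ξ ^ 2 + r * η ^ 2) * Q 1)) +
        δ * ωx ^ 2 + g * ωx) :
    P₁ 0 = 0 ∧ Q 0 = 0 := by
  -- The derivative `m = w_tt` is unconstrained, and it enters the new equation with the coefficient
  -- `f * J * i ^ 3 * (P₁ 0 + p * Q 0) ^ 2`, where `J` is the Jacobian in `hjac`. Comparing `m = 1`
  -- with `m = 0` kills it. As `d ≠ 0`, a suitable `r` exists for all `τ`, `p`, and the extra
  -- determinant factor makes the polynomial identity hold at the singular pairs too.
  have htime (τ p : ℝ) : ((P₀ 0 + τ * Q 0) * (P₁ 1 + p * Q 1) -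
      (P₁ 0 + p * Q 0) * (P₀ 1 + τ * Q 1)) * (P₁ 0 + p * Q 0) = 0 := by
    by_cases hΔ : (P₀ 0 + τ * Q 0) * (P₁ 1 + p * Q 1) -
      (P₁ 0 + p * Q 0) * (P₀ 1 + τ * Q 1) = 0
    · rw [hΔ, zero_mul]
    obtain ⟨i, hi⟩ : ∃ i, i * ((P₀ 0 + τ * Q 0) * (P₁ 1 + p * Q 1) -
      (P₁ 0 + p * Q 0) * (P₀ 1 + τ * Q 1)) = 1 := ⟨_, inv_mul_cancel₀ hΔ⟩
    have hr : τ = d * ((τ - a * p ^ 2 - k * p) / d) + a * p ^ 2 + k * p := by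
      field_simp; ring
    have key (m : ℝ) := hJ τ p m ((τ - a * p ^ 2 - k * p) / d) (-(P₁ 0 + p * Q 0) * i)
      ((P₀ 0 + τ * Q 0) * i)
      (((P₀ 2 + τ * Q 2) * (P₁ 1 + p * Q 1) - (P₁ 2 + p * Q 2) * (P₀ 1 + τ * Q 1)) * i)
      (((P₀ 0 + τ * Q 0) * (P₁ 2 + p * Q 2) - (P₁ 0 + p * Q 0) * (P₀ 2 + τ * Q 2)) * i) hr hΔ
      (by linear_combination (P₀ 2 + τ * Q 2) * hi)
      (by linear_combination (P₁ 2 + p * Q 2) * hi)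
      (by ring) (by linear_combination hi)
    have h := (key 1).symm.trans (key 0)
    have h' : (f * (P₀ 0 * (P₁ 1 * Q 2 - Q 1 * P₁ 2) - P₁ 0 * (P₀ 1 * Q 2 - Q 1 * P₀ 2) +
      Q 0 * (P₀ 1 * P₁ 2 - P₁ 1 * P₀ 2)) * i ^ 3) * (P₁ 0 + p * Q 0) ^ 2 = 0 := by
      linear_combination h + f * (P₁ 0 + p * Q 0) ^ 2 * i ^ 2 * Q 2 * hi
    have hi0 : i ≠ 0 := left_ne_zero_of_mul_eq_one hi
    have := (mul_eq_zero.1 h').resolve_left (by positivity)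
    rw [pow_eq_zero_iff (by norm_num)] at this
    rw [this, mul_zero]
  -- The determinant in `htime` is affine in `τ` and `p`, since its `τ * p` terms cancel, and its
  -- coefficients are these three minors. The Jacobian expands along them, so they cannot all
  -- vanish; below they are extracted by finite differences.
  have hminors : (P₀ 0 * P₁ 1 - P₁ 0 * P₀ 1) = 0 → (Q 0 * P₁ 1 - P₁ 0 * Q 1) = 0 →
      (P₀ 0 * Q 1 - Q 0 * P₀ 1) = 0 → False := by
    intro h0 h1 h2
    refine hjac ?_
    linear_combination Q 2 * h0 - P₀ 2 * h1 - P₁ 2 * h2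
  have hQ0 : Q 0 = 0 := by
    by_contra hne
    have h2 : P₀ 0 * Q 1 - Q 0 * P₀ 1 = 0 := mul_right_cancel₀ hne (by
      linear_combination (htime 0 1 + htime 0 (-1) - 2 * htime 0 0) / 2)
    have h1 : Q 0 * P₁ 1 - P₁ 0 * Q 1 = 0 := mul_right_cancel₀ hne (by
      linear_combination htime 1 1 - htime 0 1 - htime 1 0 + htime 0 0)
    refine hminors (mul_right_cancel₀ hne ?_) h1 h2
    linear_combination (htime 0 1 - htime 0 (-1)) / 2 - P₁ 0 * h2
  refine ⟨?_, hQ0⟩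
  by_contra hne
  simp only [hQ0] at htime hminors
  refine hminors (mul_right_cancel₀ hne ?_) (mul_right_cancel₀ hne ?_) (mul_right_cancel₀ hne ?_)
  · linear_combination htime 0 0
  · linear_combination htime 1 0 - htime 0 0
  · linear_combination htime 0 1 - htime 0 0

/-- The linear algebra behind the form of the new `x`, see `time_of_jet_condition`. -/
theorem space_of_jet_condition {P₀ P₁ Q : ExtSpace} {d a k f δ g : ℝ} {H : ℝ → ℝ → ExtSpace}
    (hd : d ≠ 0)
    (hjac : P₀ 0 * (P₁ 1 * Q 2 - Q 1 * P₁ 2) ≠ 0)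
    (hJ : ∀ τ p r η ωt ωx : ℝ, τ = d * r + a * p ^ 2 + k * p →
      P₁ 1 + p * Q 1 ≠ 0 →
      ωt * P₀ 0 + ωx * (P₀ 1 + τ * Q 1) = P₀ 2 + τ * Q 2 →
      ωx * (P₁ 1 + p * Q 1) = P₁ 2 + p * Q 2 →
      η * (P₁ 1 + p * Q 1) = 1 →
      ωt = f * ((H η (p * η) 2 + r * η ^ 2 * Q 2) -
          ωx * (H η (p * η) 1 + r * η ^ 2 * Q 1)) +
        δ * ωx ^ 2 + g * ωx) :
    Q 1 = 0 ∧ f * P₀ 0 = d * P₁ 1 ^ 2 := by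
  have hP00 : P₀ 0 ≠ 0 := left_ne_zero_of_mul hjac
  have hj' := right_ne_zero_of_mul hjac
  -- Here `ξ = 0`, and `τ` moves with `r`. Comparing `r = 1` with `r = 0` equates the coefficients
  -- of `w_xx` in both equations; the factor `P₁ 1 + p * Q 1` again covers the singular `p`.
  have hspace (p : ℝ) : (P₁ 1 + p * Q 1) * (d * (P₁ 1 + p * Q 1) ^ 2 - f * P₀ 0) = 0 := by
    by_cases hΔ : P₁ 1 + p * Q 1 = 0
    · rw [hΔ, zero_mul]
    obtain ⟨i, hi⟩ : ∃ i, i * (P₁ 1 + p * Q 1) = 1 := ⟨_, inv_mul_cancel₀ hΔ⟩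
    obtain ⟨θ, hθ⟩ : ∃ θ, θ * P₀ 0 = 1 := ⟨_, inv_mul_cancel₀ hP00⟩
    have key (r : ℝ) := hJ (d * r + a * p ^ 2 + k * p) p r i
      (θ * (P₀ 2 + (d * r + a * p ^ 2 + k * p) * Q 2 -
        (P₁ 2 + p * Q 2) * i * (P₀ 1 + (d * r + a * p ^ 2 + k * p) * Q 1)))
      ((P₁ 2 + p * Q 2) * i) rfl hΔ
      (by linear_combination (P₀ 2 + (d * r + a * p ^ 2 + k * p) * Q 2 -
        (P₁ 2 + p * Q 2) * i * (P₀ 1 + (d * r + a * p ^ 2 + k * p) * Q 1)) * hθ)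
      (by linear_combination (P₁ 2 + p * Q 2) * hi) hi
    have h : i * (P₁ 1 * Q 2 - Q 1 * P₁ 2) * (θ * d - f * i ^ 2) = 0 := by
      linear_combination key 1 - key 0 + Q 2 * (θ * d - f * i ^ 2) * hi
    have hi0 : i ≠ 0 := left_ne_zero_of_mul_eq_one hi
    have h1 := (mul_eq_zero.1 h).resolve_left (mul_ne_zero hi0 hj')
    have h2 : d * (P₁ 1 + p * Q 1) ^ 2 - f * P₀ 0 = 0 := by
      linear_combination P₀ 0 * (P₁ 1 + p * Q 1) ^ 2 * h1 - d * (P₁ 1 + p * Q 1) ^ 2 * hθ +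
        f * P₀ 0 * (i * (P₁ 1 + p * Q 1) + 1) * hi
    rw [h2, mul_zero]
  have hQ1 : Q 1 = 0 := by
    -- The third difference of a cubic in `p` is six times its leading coefficient, here `d * Q 1 ^
    -- 3`.
    have : 6 * d * Q 1 ^ 3 = 0 := by
      linear_combination hspace 3 - 3 * hspace 2 + 3 * hspace 1 - hspace 0
    simpa [hd] using this
  refine ⟨hQ1, ?_⟩
  have h := hspace 0
  simp only [hQ1, mul_zero, add_zero] at h
  have hP11 : P₁ 1 ≠ 0 := by
    rw [hQ1] at hj'
    exact left_ne_zero_of_mul (by simpa using hj')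
  linear_combination -(mul_eq_zero.1 h).resolve_left hP11

/-! ### Jacobian of the induced map and the condition at a point -/

/-- The derivative of `liftPoint D K` for `D_u = a`, `K_u = b`. -/
noncomputable def liftDeriv (a b : ℝ) : BaseSpace →L[ℝ] ExtSpace :=
  ContinuousLinearMap.pi ![ContinuousLinearMap.proj 0, ContinuousLinearMap.proj 1,
    ContinuousLinearMap.proj 2, a • ContinuousLinearMap.proj 2, b • ContinuousLinearMap.proj 2]

theorem liftDeriv_apply (a b : ℝ) (v : BaseSpace) :
    liftDeriv a b v = ![v 0, v 1, v 2, a * v 2, b * v 2] := by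
  ext i
  fin_cases i <;> simp [liftDeriv]

theorem hasFDerivAt_liftPoint {D K : ℝ → ℝ} {a b : ℝ} {q : BaseSpace}
    (hD : HasDerivAt D a (q 2)) (hK : HasDerivAt K b (q 2)) :
    HasFDerivAt (liftPoint D K) (liftDeriv a b) q := by
  have hq (i : Fin 3) : HasFDerivAt (fun q : BaseSpace => q i)
      (ContinuousLinearMap.proj (R := ℝ) (φ := fun _ : Fin 3 => ℝ) i) q :=
    (ContinuousLinearMap.proj (R := ℝ) (φ := fun _ : Fin 3 => ℝ) i).hasFDerivAt
  refine hasFDerivAt_pi.2 fun i => ?_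
  fin_cases i
  · exact hq 0
  · exact hq 1
  · exact hq 2
  · exact hD.comp_hasFDerivAt q (hq 2)
  · exact hK.comp_hasFDerivAt q (hq 2)

/-- The Jacobian determinant of the induced map of `(t, x, u)`, for a transformation of the extended
space with the derivative `L` and arbitrary elements with `D_u = a`, `K_u = b`. -/
def inducedJacobian (L : ExtSpace →L[ℝ] ExtSpace) (a b : ℝ) : ℝ :=
  L ![1, 0, 0, 0, 0] 0 * (L ![0, 1, 0, 0, 0] 1 * L ![0, 0, 1, a, b] 2 -
      L ![0, 0, 1, a, b] 1 * L ![0, 1, 0, 0, 0] 2) -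
    L ![0, 1, 0, 0, 0] 0 * (L ![1, 0, 0, 0, 0] 1 * L ![0, 0, 1, a, b] 2 -
      L ![0, 0, 1, a, b] 1 * L ![1, 0, 0, 0, 0] 2) +
    L ![0, 0, 1, a, b] 0 * (L ![1, 0, 0, 0, 0] 1 * L ![0, 1, 0, 0, 0] 2 -
      L ![0, 1, 0, 0, 0] 1 * L ![1, 0, 0, 0, 0] 2)

theorem map_liftVector {F : Type*} [AddCommGroup F] [Module ℝ F] [TopologicalSpace F]
    (L : ExtSpace →L[ℝ] F) (a b v₀ v₁ v₂ : ℝ) :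
    L ![v₀, v₁, v₂, a * v₂, b * v₂] =
      v₀ • L ![1, 0, 0, 0, 0] + v₁ • L ![0, 1, 0, 0, 0] + v₂ • L ![0, 0, 1, a, b] := by
  rw [← map_smul, ← map_smul, ← map_smul, ← map_add, ← map_add]
  congr 1
  ext i
  fin_cases i <;> simp [mul_comm]

theorem map_totalVector {F : Type*} [AddCommGroup F] [Module ℝ F] [TopologicalSpace F]
    (L : ExtSpace →L[ℝ] F) (a b : ℝ) :
    L ![0, 0, 1, a, b] =
      L ![0, 0, 1, 0, 0] + a • L ![0, 0, 0, 1, 0] + b • L ![0, 0, 0, 0, 1] := by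
  rw [← map_smul, ← map_smul, ← map_add, ← map_add]
  congr 1
  ext i
  fin_cases i <;> simp

/-- Nonsingularity depends only on the first derivative of the transformation and on the slopes `a`,
`b`, through a determinant. This makes it an open condition on the point and the slopes. -/
theorem nonsingularAt_inducedMap_iff {Φ : ExtSpace → ExtSpace} {D K : ℝ → ℝ} {a b : ℝ}
    {q : BaseSpace} {L : ExtSpace →L[ℝ] ExtSpace} (hΦ : HasFDerivAt Φ L (liftPoint D K q))
    (hD : HasDerivAt D a (q 2)) (hK : HasDerivAt K b (q 2)) :
    NonsingularAt (inducedMap Φ D K) q ↔ inducedJacobian L a b ≠ 0 := by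
  let M : Matrix (Fin 3) (Fin 3) ℝ :=
    !![L ![1, 0, 0, 0, 0] 0, L ![0, 1, 0, 0, 0] 0, L ![0, 0, 1, a, b] 0;
       L ![1, 0, 0, 0, 0] 1, L ![0, 1, 0, 0, 0] 1, L ![0, 0, 1, a, b] 1;
       L ![1, 0, 0, 0, 0] 2, L ![0, 1, 0, 0, 0] 2, L ![0, 0, 1, a, b] 2]
  have hM : M.det = inducedJacobian L a b := by
    rw [Matrix.det_fin_three]; simp [M, inducedJacobian]; ring
  have hcomp := hasFDerivAt_pi'.1 (hΦ.comp q (hasFDerivAt_liftPoint hD hK))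
  have hind : HasFDerivAt (inducedMap Φ D K) (ContinuousLinearMap.pi fun i : Fin 3 =>
      (ContinuousLinearMap.proj (R := ℝ) (φ := fun _ : Fin 5 => ℝ) (Fin.castLE (by norm_num) i)).comp
        (L.comp (liftDeriv a b))) q := by
    refine hasFDerivAt_pi.2 fun i => ?_
    fin_cases i
    · exact hcomp 0
    · exact hcomp 1
    · exact hcomp 2
  have hmul : (fderiv ℝ (inducedMap Φ D K) q : BaseSpace → BaseSpace) = M.mulVec := by
    funext v i
    rw [hind.fderiv]
    simp only [ContinuousLinearMap.coe_pi', ContinuousLinearMap.comp_apply, liftDeriv_apply,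
      map_liftVector, ContinuousLinearMap.proj_apply]
    fin_cases i <;> simp [M, Matrix.mulVec, dotProduct, Fin.sum_univ_three, mul_comm]
  unfold NonsingularAt
  rw [hmul, ← hM, ← isUnit_iff_ne_zero, ← Matrix.isUnit_iff_isUnit_det]
  exact ⟨fun h => Matrix.mulVec_injective_iff_isUnit.1 h.1, fun h =>
    ⟨Matrix.mulVec_injective_iff_isUnit.2 h, Matrix.mulVec_surjective_iff_isUnit.2 h⟩⟩

theorem isArbitraryElementAt_quadratic {d a : ℝ} (hd : d ≠ 0) (ha : a ≠ 0) (k b c e u₀ : ℝ) :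
    IsArbitraryElementAt (quadratic d a c u₀) (quadratic k b e u₀) u₀ where
  smooth_D := .of_forall fun _ => (contDiff_quadratic _ _ _ _).contDiffAt
  smooth_K := .of_forall fun _ => (contDiff_quadratic _ _ _ _).contDiffAt
  ne_zero := by rwa [quadratic_self]
  nonlinear h := ha (by
    have := h.self_of_nhds.1
    rw [(hasDerivAt_quadratic _ _ _ _ _).deriv] at this
    simpa using this)

/-- The second derivative of `Φ` along the curve in the graph of the arbitrary elements
over a line in `(t, x, u)` with the direction `(ξ, η, u)`. -/
noncomputable def curveHessian (Φ : ExtSpace → ExtSpace) (z : ExtSpace) (a b c e ξ η u : ℝ) :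
    ExtSpace :=
  fderiv ℝ (fderiv ℝ Φ) z ![ξ, η, u, a * u, b * u] ![ξ, η, u, a * u, b * u] +
    u ^ 2 • fderiv ℝ Φ z ![0, 0, 0, c, e]

/-- What the invariance of the class under an equivalence transformation says at a point: with
`δ`, `κ` the derivatives of the transformed arbitrary elements, these elements depend on the new `u`
only, and the 2-jets of solutions are carried to 2-jets of solutions. -/
theorem IsEquivalenceTransformation.exists_jet_condition
    {Φ : OpenPartialHomeomorph ExtSpace ExtSpace} (h : IsEquivalenceTransformation Φ)
    {z : ExtSpace} (hz : z ∈ Φ.source) {a b : ℝ} (ha : a ≠ 0) {L : ExtSpace →L[ℝ] ExtSpace}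
    (hL : fderiv ℝ Φ z = L) (hjac : inducedJacobian L a b ≠ 0) {P₀ P₁ Q : ExtSpace}
    (hP₀ : L ![1, 0, 0, 0, 0] = P₀) (hP₁ : L ![0, 1, 0, 0, 0] = P₁)
    (hQ : L ![0, 0, 1, a, b] = Q) (c e : ℝ) {H : ℝ → ℝ → ℝ → ExtSpace}
    (hH : curveHessian Φ z a b c e = H) :
    ∃ δ κ : ℝ, Φ z 3 ≠ 0 ∧
      (P₀ 3 = δ * P₀ 2 ∧ P₁ 3 = δ * P₁ 2 ∧ Q 3 = δ * Q 2) ∧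
      (P₀ 4 = κ * P₀ 2 ∧ P₁ 4 = κ * P₁ 2 ∧ Q 4 = κ * Q 2) ∧
      ∀ τ p m r ξ η ωt ωx : ℝ, τ = z 3 * r + a * p ^ 2 + z 4 * p →
      (P₀ 0 + τ * Q 0) * (P₁ 1 + p * Q 1) - (P₁ 0 + p * Q 0) * (P₀ 1 + τ * Q 1) ≠ 0 →
      ωt * (P₀ 0 + τ * Q 0) + ωx * (P₀ 1 + τ * Q 1) = P₀ 2 + τ * Q 2 →
      ωt * (P₁ 0 + p * Q 0) + ωx * (P₁ 1 + p * Q 1) = P₁ 2 + p * Q 2 →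
      ξ * (P₀ 0 + τ * Q 0) + η * (P₁ 0 + p * Q 0) = 0 →
      ξ * (P₀ 1 + τ * Q 1) + η * (P₁ 1 + p * Q 1) = 1 →
      ωt = Φ z 3 * ((H ξ η (τ * ξ + p * η) 2 + (m * ξ ^ 2 + r * η ^ 2) * Q 2) -
          ωt * (H ξ η (τ * ξ + p * η) 0 + (m * ξ ^ 2 + r * η ^ 2) * Q 0) -
          ωx * (H ξ η (τ * ξ + p * η) 1 + (m * ξ ^ 2 + r * η ^ 2) * Q 1)) +
        δ * ωx ^ 2 + Φ z 4 * ωx := by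
  set D := quadratic (z 3) a c (z 2) with hD
  set K := quadratic (z 4) b e (z 2) with hK
  have hDd : HasDerivAt D a (z 2) := by simpa using hasDerivAt_quadratic (z 3) a c (z 2) (z 2)
  have hKd : HasDerivAt K b (z 2) := by simpa using hasDerivAt_quadratic (z 4) b e (z 2) (z 2)
  have hlift : liftPoint D K ![z 0, z 1, z 2] = z := liftPoint_quadratic z a b c e
  have hΦ : ContDiffAt ℝ ∞ Φ z := h.smooth.contDiffAt (Φ.open_source.mem_nhds hz)
  have hΦd : HasFDerivAt Φ L (liftPoint D K ![z 0, z 1, z 2]) := by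
    rw [hlift, ← hL]; exact (hΦ.differentiableAt (by simp)).hasFDerivAt
  have hz3 : z 3 ≠ 0 := h.source_subset hz
  -- A nonzero slope of `D` at the point ensures nonlinearity, whatever `b`, `c`, `e` are.
  obtain ⟨D', K', hel, hev⟩ := h.preserves D K ![z 0, z 1, z 2]
    (isArbitraryElementAt_quadratic hz3 ha _ _ _ _ _) (by rwa [hlift])
    ((nonsingularAt_inducedMap_iff hΦd hDd hKd).2 hjac)
  have hU : inducedMap Φ D K ![z 0, z 1, z 2] 2 = Φ z 2 := by simp [inducedMap, hlift]
  rw [hU] at hel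
  have hD' := hel.smooth_D.self_of_nhds.differentiableAt (by simp)
  have hK' := hel.smooth_K.self_of_nhds.differentiableAt (by simp)
  obtain ⟨hD0, hK0, hcar⟩ := hev.self_of_nhds
  rw [hU, hlift] at hD0 hK0
  have hcomp := hasFDerivAt_pi'.1
    (hΦd.comp (![z 0, z 1, z 2] : BaseSpace) (hasFDerivAt_liftPoint hDd hKd))
  -- By the chain rule, a component that is a function `f` of the new `u` has all its derivatives
  -- along the coefficients proportional to those of the new `u`, with the common factor `f'`. This
  -- yields `δ` and `κ`.
  have hdep {f : ℝ → ℝ} {j : Fin 5} (hf : DifferentiableAt ℝ f (Φ z 2))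
      (hfe : ∀ᶠ q in 𝓝 (![z 0, z 1, z 2] : BaseSpace),
        Φ (liftPoint D K q) j = f (inducedMap Φ D K q 2)) (v : BaseSpace) :
      L (liftDeriv a b v) j = deriv f (Φ z 2) * L (liftDeriv a b v) 2 := by
    have hf' : HasDerivAt f (deriv f (Φ z 2)) ((Φ ∘ liftPoint D K) ![z 0, z 1, z 2] 2) := by
      rw [Function.comp_apply, hlift]; exact hf.hasDerivAt
    have h1 := HasDerivAt.comp_hasFDerivAt (f := fun x => (Φ ∘ liftPoint D K) x 2) _ hf' (hcomp 2)
    exact congrArg (fun l => l v) ((hcomp j).unique (h1.congr_of_eventuallyEq hfe))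
  have hdep3 := hdep hD' (hev.mono fun _ h => h.1)
  have hdep4 := hdep hK' (hev.mono fun _ h => h.2.1)
  have hv₀ : liftDeriv a b ![1, 0, 0] = ![1, 0, 0, 0, 0] := by simp [liftDeriv_apply]
  have hv₁ : liftDeriv a b ![0, 1, 0] = ![0, 1, 0, 0, 0] := by simp [liftDeriv_apply]
  have hv₂ : liftDeriv a b ![0, 0, 1] = ![0, 0, 1, a, b] := by simp [liftDeriv_apply]
  refine ⟨deriv D' (Φ z 2), deriv K' (Φ z 2), by rw [hD0]; exact hel.ne_zero, ⟨?_, ?_, ?_⟩,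
    ⟨?_, ?_, ?_⟩, ?_⟩
  · simpa [hv₀, hP₀] using hdep3 ![1, 0, 0]
  · simpa [hv₁, hP₁] using hdep3 ![0, 1, 0]
  · simpa [hv₂, hQ] using hdep3 ![0, 0, 1]
  · simpa [hv₀, hP₀] using hdep4 ![1, 0, 0]
  · simpa [hv₁, hP₁] using hdep4 ![0, 1, 0]
  · simpa [hv₂, hQ] using hdep4 ![0, 0, 1]
  intro τ p m r ξ η ωt ωx hE hdet hω₀ hω₁ hξ hη
  have hA₀ : fderiv ℝ Φ z ![1, 0, τ, a * τ, b * τ] = P₀ + τ • Q := by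
    rw [hL, map_liftVector, hP₀, hQ]; simp
  have hA₁ : fderiv ℝ Φ z ![0, 1, p, a * p, b * p] = P₁ + p • Q := by
    rw [hL, map_liftVector, hP₁, hQ]; simp
  have hΓ (u ρ : ℝ) : fderiv ℝ Φ z ![0, 0, ρ, c * u ^ 2 + a * ρ, e * u ^ 2 + b * ρ] =
      u ^ 2 • L ![0, 0, 0, c, e] + ρ • Q := by
    rw [hL, ← hQ, ← map_smul, ← map_smul, ← map_add]
    congr 1
    ext i
    fin_cases i <;> simp [mul_comm]
  have key := CarriesEquationAt.transformed_jet hΦ hD' hcar hE hA₀ hA₁ hdet hω₀ hω₁ hξ hη rfl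
    (m := m) rfl (S := H ξ η (τ * ξ + p * η) + (m * ξ ^ 2 + r * η ^ 2) • Q)
    (by rw [hΓ, ← hH, curveHessian, hL, add_assoc])
  rw [hD0, hK0]
  exact key

/-- The linear algebra behind the form of the new `u` and `K`, see `time_of_jet_condition`. -/
theorem value_of_jet_condition {p₀₀ p₀₁ p₀₂ p₁₁ p₁₂ q₂ q₃ d a k f δ g η x₁₁ h₁₁ h₁₂ h₂₂ : ℝ}
    (hd : d ≠ 0) (hp₀₀ : p₀₀ ≠ 0) (hq₂ : q₂ ≠ 0) (hη : η * p₁₁ = 1)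
    (hf : f * p₀₀ = d * p₁₁ ^ 2) (hq₃ : q₃ * p₀₀ = a * p₁₁ ^ 2) (hδ : q₃ = δ * q₂)
    (hJ : ∀ p ωt ωx : ℝ, ωt * p₀₀ + ωx * p₀₁ = p₀₂ + (a * p ^ 2 + k * p) * q₂ →
      ωx * p₁₁ = p₁₂ + p * q₂ →
      ωt = f * (η ^ 2 * (h₁₁ + 2 * p * h₁₂ + p ^ 2 * h₂₂) - ωx * (η ^ 2 * x₁₁)) +
        δ * ωx ^ 2 + g * ωx) :
    h₂₂ = 0 ∧ (p₁₂ = 0 → h₁₂ = 0 → x₁₁ = 0 → g * p₀₀ = k * p₁₁ - p₀₁) := by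
  obtain ⟨θ, hθ⟩ : ∃ θ, θ * p₀₀ = 1 := ⟨_, inv_mul_cancel₀ hp₀₀⟩
  have key (p : ℝ) := hJ p
    (θ * (p₀₂ + (a * p ^ 2 + k * p) * q₂ - (p₁₂ + p * q₂) * η * p₀₁)) ((p₁₂ + p * q₂) * η)
    (by linear_combination (p₀₂ + (a * p ^ 2 + k * p) * q₂ - (p₁₂ + p * q₂) * η * p₀₁) * hθ)
    (by linear_combination (p₁₂ + p * q₂) * hη)
  have hfη : f * η ^ 2 = d * θ := by
    linear_combination θ * η ^ 2 * hf - f * η ^ 2 * hθ + d * θ * (η * p₁₁ + 1) * hη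
  have hδη : δ * q₂ * η ^ 2 = a * θ := by
    linear_combination θ * η ^ 2 * hq₃ - q₃ * η ^ 2 * hθ + a * θ * (η * p₁₁ + 1) * hη - η ^ 2 * hδ
  have hθ0 : θ ≠ 0 := left_ne_zero_of_mul_eq_one hθ
  have hη0 : η ≠ 0 := left_ne_zero_of_mul_eq_one hη
  constructor
  -- The second difference in `p` isolates the coefficient of `p ^ 2`. The contributions of `D_u` to
  -- both equations cancel by `hδη`, the differentiated rule for `D`.
  · have h : d * θ * h₂₂ = 0 := by
      linear_combination (-key 1 - key (-1) + 2 * key 0) / 2 - h₂₂ * hfη - q₂ * hδη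
    simpa [hd, hθ0] using h
  · intro h1 h2 h3
    subst h1 h2 h3
    -- The odd part in `p` isolates the linear coefficient.
    have h : q₂ * (θ * (k - η * p₀₁) - g * η) = 0 := by
      linear_combination (key 1 - key (-1)) / 2
    have h' := (mul_eq_zero.1 h).resolve_left hq₂
    linear_combination -p₁₁ * p₀₀ * h' + (k * p₁₁ - p₀₁) * hθ
      - (g * p₀₀ + p₀₁ * θ * p₀₀) * hη

/-! ### Derivatives on the extended space and regular boxes -/

theorem map_extVector {F : Type*} [AddCommGroup F] [Module ℝ F] [TopologicalSpace F]
    (L : ExtSpace →L[ℝ] F) (w : ExtSpace) :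
    L w = w 0 • L ![1, 0, 0, 0, 0] + w 1 • L ![0, 1, 0, 0, 0] + w 2 • L ![0, 0, 1, 0, 0] +
      w 3 • L ![0, 0, 0, 1, 0] + w 4 • L ![0, 0, 0, 0, 1] := by
  simp only [← map_smul, ← map_add]
  congr 1
  ext i
  fin_cases i <;> simp

theorem hasFDerivAt_fderiv_apply {f : ExtSpace → ExtSpace} {z : ExtSpace}
    (hf : ContDiffAt ℝ ∞ f z) (w : ExtSpace) (i : Fin 5) :
    HasFDerivAt (fun y => fderiv ℝ f y w i)
      ((ContinuousLinearMap.proj i).comp ((fderiv ℝ (fderiv ℝ f) z).flip w) : ExtSpace →L[ℝ] ℝ)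
      z := by
  have h1 : DifferentiableAt ℝ (fderiv ℝ f) z :=
    ((hf.of_le two_le_smooth).fderiv_right (m := 1) (by norm_num)).differentiableAt (by simp)
  have h2 := h1.hasFDerivAt.clm_apply (hasFDerivAt_const w z)
  exact (hasFDerivAt_pi'.1 h2 i).congr_fderiv (by ext; simp)

theorem fderiv_fderiv_apply_eq_zero {f : ExtSpace → ExtSpace} {U : Set ExtSpace} (hU : IsOpen U)
    (hf : ContDiffOn ℝ ∞ f U) {w : ExtSpace} {i : Fin 5} (h : ∀ y ∈ U, fderiv ℝ f y w i = 0)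
    {z : ExtSpace} (hz : z ∈ U) (v : ExtSpace) : fderiv ℝ (fderiv ℝ f) z v w i = 0 := by
  have h1 := hasFDerivAt_fderiv_apply (hf.contDiffAt (hU.mem_nhds hz)) w i
  have h2 : HasFDerivAt (fun _ => (0 : ℝ)) _ z := h1.congr_of_eventuallyEq
    (eventually_of_mem (hU.mem_nhds hz) fun y hy => (h y hy).symm)
  exact congrArg (fun l => l v) (h2.unique (hasFDerivAt_const (0 : ℝ) z))

theorem fderiv_fderiv_symm {f : ExtSpace → ExtSpace} {z : ExtSpace} (hf : ContDiffAt ℝ ∞ f z)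
    (v w : ExtSpace) : fderiv ℝ (fderiv ℝ f) z v w = fderiv ℝ (fderiv ℝ f) z w v :=
  hf.isSymmSndFDerivAt (by simpa using two_le_smooth) v w

/-- A box in the source of an equivalence transformation over which the transformation acts
nonsingularly on `(t, x, u)` for all arbitrary elements with `(D_u, K_u)` near `(a₁, b₁)`. -/
structure IsRegularBox (Φ : OpenPartialHomeomorph ExtSpace ExtSpace) (z₀ : ExtSpace)
    (r a₁ b₁ : ℝ) : Prop where
  equiv : IsEquivalenceTransformation Φ
  pos : 0 < r
  subset : Metric.ball z₀ r ⊆ Φ.source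
  slope : ∀ a ∈ Metric.ball a₁ r, a ≠ 0
  jacobian : ∀ z ∈ Metric.ball z₀ r, ∀ a ∈ Metric.ball a₁ r, ∀ b ∈ Metric.ball b₁ r,
    inducedJacobian (fderiv ℝ Φ z) a b ≠ 0

theorem IsEquivalenceTransformation.exists_regularBox
    {Φ : OpenPartialHomeomorph ExtSpace ExtSpace} (h : IsEquivalenceTransformation Φ)
    {z₀ : ExtSpace} (hz₀ : z₀ ∈ Φ.source) : ∃ r a₁ b₁, IsRegularBox Φ z₀ r a₁ b₁ := by
  obtain ⟨D, K, q, hel, hlift, hns⟩ := h.nondegenerate z₀ hz₀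
  have hΦ : ContDiffAt ℝ ∞ Φ z₀ := h.smooth.contDiffAt (Φ.open_source.mem_nhds hz₀)
  have hΦd : HasFDerivAt Φ (fderiv ℝ Φ z₀) (liftPoint D K q) := by
    rw [hlift]; exact (hΦ.differentiableAt (by simp)).hasFDerivAt
  rw [nonsingularAt_inducedMap_iff hΦd
    (hel.smooth_D.self_of_nhds.differentiableAt (by simp)).hasDerivAt
    (hel.smooth_K.self_of_nhds.differentiableAt (by simp)).hasDerivAt] at hns
  have hcont (p : ExtSpace × ℝ × ℝ) (hp : p.1 = z₀) : ContinuousAt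
      (fun p : ExtSpace × ℝ × ℝ => inducedJacobian (fderiv ℝ Φ p.1) p.2.1 p.2.2) p := by
    have hL : ContinuousAt (fun p : ExtSpace × ℝ × ℝ => fderiv ℝ Φ p.1) p := by
      have : ContinuousAt (fderiv ℝ Φ) p.1 := by
        rw [hp]; exact (hΦ.fderiv_right (m := 0) (by simp)).continuousAt
      exact this.comp continuousAt_fst
    have h1 (v : ExtSpace × ℝ × ℝ → ExtSpace) (hv : Continuous v) (i : Fin 5) :
        ContinuousAt (fun p : ExtSpace × ℝ × ℝ => fderiv ℝ Φ p.1 (v p) i) p :=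
      continuousAt_pi.1 (hL.clm_apply hv.continuousAt) i
    have hv : Continuous fun p : ExtSpace × ℝ × ℝ => (![0, 0, 1, p.2.1, p.2.2] : ExtSpace) := by
      refine continuous_pi fun i => ?_
      fin_cases i <;> simp <;> fun_prop
    have h2 := h1 _ hv
    have h3 := h1 (fun _ => ![1, 0, 0, 0, 0]) continuous_const
    have h4 := h1 (fun _ => ![0, 1, 0, 0, 0]) continuous_const
    unfold inducedJacobian
    fun_prop
  set a₀ := deriv D (q 2)
  set b₀ := deriv K (q 2)
  -- The given coefficients may have `D_u = 0` at the point. The Jacobian stays nonzero for nearby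
  -- slopes, so a nonzero slope can be used instead.
  obtain ⟨a₁, ha₁, hja⟩ : ∃ a₁, a₁ ≠ 0 ∧ inducedJacobian (fderiv ℝ Φ z₀) a₁ b₀ ≠ 0 := by
    have hc : ContinuousAt (fun a => inducedJacobian (fderiv ℝ Φ z₀) a b₀) a₀ :=
      ContinuousAt.comp (f := fun a : ℝ => (z₀, a, b₀)) (hcont (z₀, a₀, b₀) rfl)
        (by fun_prop)
    obtain ⟨a₁, h1, h2⟩ := ((dense_compl_singleton (0 : ℝ)).inter_nhds_nonempty
      (hc.eventually_ne hns))
    exact ⟨a₁, h1, h2⟩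
  have hev := (hcont (z₀, a₁, b₀) rfl).eventually_ne hja
  have hev' : ∀ᶠ p : ExtSpace × ℝ × ℝ in 𝓝 (z₀, a₁, b₀), p.1 ∈ Φ.source ∧ p.2.1 ≠ 0 ∧
      inducedJacobian (fderiv ℝ Φ p.1) p.2.1 p.2.2 ≠ 0 := by
    have h1 : ∀ᶠ p : ExtSpace × ℝ × ℝ in 𝓝 (z₀, a₁, b₀), p.1 ∈ Φ.source :=
      continuousAt_fst.eventually_mem (Φ.open_source.mem_nhds hz₀)
    have h2 : ∀ᶠ p : ExtSpace × ℝ × ℝ in 𝓝 (z₀, a₁, b₀), p.2.1 ≠ 0 :=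
      (by fun_prop : Continuous fun p : ExtSpace × ℝ × ℝ => p.2.1).continuousAt.eventually_ne ha₁
    exact h1.and (h2.and hev)
  obtain ⟨r, hr, hball⟩ := Metric.eventually_nhds_iff_ball.1 hev'
  have hmem {z : ExtSpace} {a b : ℝ} (hz : z ∈ Metric.ball z₀ r) (ha : a ∈ Metric.ball a₁ r)
      (hb : b ∈ Metric.ball b₀ r) : (z, a, b) ∈ Metric.ball (z₀, a₁, b₀) r := by
    rw [← ball_prod_same, ← ball_prod_same]
    exact ⟨hz, ha, hb⟩
  exact ⟨r, a₁, b₀, h, hr,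
    fun z hz => (hball _ (hmem hz (Metric.mem_ball_self hr) (Metric.mem_ball_self hr))).1,
    fun a ha => (hball _ (hmem (Metric.mem_ball_self hr) ha (Metric.mem_ball_self hr))).2.1,
    fun z hz a ha b hb => (hball _ (hmem hz ha hb)).2.2⟩

/-- An affine function of `(a, b)` is determined by its values at the centre and at two shifted
points. This separates the derivatives in `u`, `D`, `K` inside a total derivative once the slopes
range over open intervals. -/
theorem coeff_eq_zero_of_ball {r a₁ b₁ x y w : ℝ} (hr : 0 < r)
    (h : ∀ a ∈ Metric.ball a₁ r, ∀ b ∈ Metric.ball b₁ r, x + a * y + b * w = 0) :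
    x = 0 ∧ y = 0 ∧ w = 0 := by
  have hs (c : ℝ) : c + r / 2 ∈ Metric.ball c r := by
    rw [Metric.mem_ball, Real.dist_eq, add_sub_cancel_left, abs_of_pos (by positivity)]
    linarith
  have h0 := h a₁ (Metric.mem_ball_self hr) b₁ (Metric.mem_ball_self hr)
  have h1 := h _ (hs a₁) b₁ (Metric.mem_ball_self hr)
  have h2 := h a₁ (Metric.mem_ball_self hr) _ (hs b₁)
  have hy : y = 0 := by
    have : r / 2 * y = 0 := by linear_combination h1 - h0
    exact (mul_eq_zero.1 this).resolve_left (by positivity)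
  have hw : w = 0 := by
    have : r / 2 * w = 0 := by linear_combination h2 - h0
    exact (mul_eq_zero.1 this).resolve_left (by positivity)
  subst hy hw
  exact ⟨by linear_combination h0, rfl, rfl⟩

theorem eq_of_fderiv_eq_zero {f : ExtSpace → ℝ} {s : Set ExtSpace} (hs : IsOpen s)
    (hs' : IsPreconnected s) (hf : ∀ z ∈ s, HasFDerivAt f (0 : ExtSpace →L[ℝ] ℝ) z)
    {x y : ExtSpace} (hx : x ∈ s) (hy : y ∈ s) : f x = f y :=
  hs.is_const_of_fderiv_eq_zero hs'
    (fun z hz => (hf z hz).differentiableAt.differentiableWithinAt)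
    (fun z hz => (hf z hz).fderiv) hx hy

/-! ### Determining equations on a regular box -/

namespace IsRegularBox

variable {Φ : OpenPartialHomeomorph ExtSpace ExtSpace} {z₀ : ExtSpace} {r a₁ b₁ : ℝ}

theorem contDiffOn (B : IsRegularBox Φ z₀ r a₁ b₁) : ContDiffOn ℝ ∞ Φ (Metric.ball z₀ r) :=
  B.equiv.smooth.mono B.subset

theorem contDiffAt (B : IsRegularBox Φ z₀ r a₁ b₁) {z : ExtSpace} (hz : z ∈ Metric.ball z₀ r) :
    ContDiffAt ℝ ∞ Φ z :=
  B.contDiffOn.contDiffAt (Metric.isOpen_ball.mem_nhds hz)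

theorem three_ne_zero (B : IsRegularBox Φ z₀ r a₁ b₁) {z : ExtSpace}
    (hz : z ∈ Metric.ball z₀ r) : z 3 ≠ 0 :=
  B.equiv.source_subset (B.subset hz)

/-- The new `t` depends on `t` only. -/
theorem fderiv_zero (B : IsRegularBox Φ z₀ r a₁ b₁) {z : ExtSpace} (hz : z ∈ Metric.ball z₀ r)
    {w : ExtSpace} (hw : w 0 = 0) : fderiv ℝ Φ z w 0 = 0 := by
  have key (a : ℝ) (ha : a ∈ Metric.ball a₁ r) (b : ℝ) (hb : b ∈ Metric.ball b₁ r) :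
      fderiv ℝ Φ z ![0, 1, 0, 0, 0] 0 = 0 ∧ fderiv ℝ Φ z ![0, 0, 1, a, b] 0 = 0 := by
    obtain ⟨δ, κ, hf, -, -, hJ⟩ := B.equiv.exists_jet_condition (B.subset hz) (B.slope a ha)
      rfl (B.jacobian z hz a ha b hb) rfl rfl rfl 0 0 rfl
    exact time_of_jet_condition (B.three_ne_zero hz) hf (B.jacobian z hz a ha b hb) hJ
  have h1 := (key a₁ (Metric.mem_ball_self B.pos) b₁ (Metric.mem_ball_self B.pos)).1
  obtain ⟨h2, h3, h4⟩ := coeff_eq_zero_of_ball B.pos fun a ha b hb => by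
    simpa [map_totalVector _ a b] using (key a ha b hb).2
  rw [map_extVector]
  simp [hw, h1, h2, h3, h4]

theorem fderiv_fderiv_zero (B : IsRegularBox Φ z₀ r a₁ b₁) {z : ExtSpace}
    (hz : z ∈ Metric.ball z₀ r) {w : ExtSpace} (hw : w 0 = 0) (v : ExtSpace) :
    fderiv ℝ (fderiv ℝ Φ) z v w 0 = 0 :=
  fderiv_fderiv_apply_eq_zero Metric.isOpen_ball B.contDiffOn
    (fun _ hy => B.fderiv_zero hy hw) hz v

theorem curveHessian_zero (B : IsRegularBox Φ z₀ r a₁ b₁) {z : ExtSpace}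
    (hz : z ∈ Metric.ball z₀ r) (a b c e η u : ℝ) : curveHessian Φ z a b c e 0 η u 0 = 0 := by
  have h1 : fderiv ℝ (fderiv ℝ Φ) z ![0, η, u, a * u, b * u] ![0, η, u, a * u, b * u] 0 = 0 :=
    B.fderiv_fderiv_zero hz rfl _
  have h2 : fderiv ℝ Φ z ![0, 0, 0, c, e] 0 = 0 := B.fderiv_zero hz rfl
  simp [curveHessian, h1, h2]

/-- Since the new `t` depends on `t` only, the vector carried to the new `x`-axis has no
`t`-component, which reduces the jet condition to the one in `space_of_jet_condition`. -/
theorem fderiv_one_and_coefficient (B : IsRegularBox Φ z₀ r a₁ b₁) {z : ExtSpace}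
    (hz : z ∈ Metric.ball z₀ r) {a b : ℝ} (ha : a ∈ Metric.ball a₁ r)
    (hb : b ∈ Metric.ball b₁ r) :
    fderiv ℝ Φ z ![0, 0, 1, a, b] 1 = 0 ∧
      Φ z 3 * fderiv ℝ Φ z ![1, 0, 0, 0, 0] 0 = z 3 * fderiv ℝ Φ z ![0, 1, 0, 0, 0] 1 ^ 2 := by
  have hjac := B.jacobian z hz a ha b hb
  obtain ⟨δ, κ, hf, -, -, hJ⟩ := B.equiv.exists_jet_condition (B.subset hz) (B.slope a ha)
    rfl hjac rfl rfl rfl 0 0 rfl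
  have h1 : fderiv ℝ Φ z ![0, 1, 0, 0, 0] 0 = 0 := B.fderiv_zero hz rfl
  have hu : fderiv ℝ Φ z ![0, 0, 1, a, b] 0 = 0 := B.fderiv_zero hz rfl
  simp only [inducedJacobian, h1, hu, zero_mul, sub_zero, add_zero] at hjac
  refine space_of_jet_condition (B.three_ne_zero hz)
    (H := curveHessian Φ z a b 0 0 0) (a := a) (k := z 4) (δ := δ) (g := Φ z 4)
    hjac ?_
  intro τ p r η ωt ωx hE hΔ hωt hωx hη
  have h2 := B.curveHessian_zero hz a b 0 0 η (p * η)
  have h := hJ τ p 0 r 0 η ωt ωx hE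
    (by simpa [h1, hu] using ⟨left_ne_zero_of_mul hjac, hΔ⟩)
    (by simpa [hu] using hωt) (by simpa [h1, hu] using hωx) (by simp [h1, hu])
    (by simpa using hη)
  simpa [h2, hu] using h

/-- The new `x` depends on `t, x` only. -/
theorem fderiv_one (B : IsRegularBox Φ z₀ r a₁ b₁) {z : ExtSpace} (hz : z ∈ Metric.ball z₀ r)
    {w : ExtSpace} (hw₀ : w 0 = 0) (hw₁ : w 1 = 0) : fderiv ℝ Φ z w 1 = 0 := by
  obtain ⟨h2, h3, h4⟩ := coeff_eq_zero_of_ball B.pos fun a ha b hb => by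
    simpa [map_totalVector _ a b] using (B.fderiv_one_and_coefficient hz ha hb).1
  rw [map_extVector]
  simp [hw₀, hw₁, h2, h3, h4]

theorem fderiv_fderiv_one (B : IsRegularBox Φ z₀ r a₁ b₁) {z : ExtSpace}
    (hz : z ∈ Metric.ball z₀ r) {w : ExtSpace} (hw₀ : w 0 = 0) (hw₁ : w 1 = 0) (v : ExtSpace) :
    fderiv ℝ (fderiv ℝ Φ) z v w 1 = 0 :=
  fderiv_fderiv_apply_eq_zero Metric.isOpen_ball B.contDiffOn
    (fun _ hy => B.fderiv_one hy hw₀ hw₁) hz v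

/-- The transformation rule for `D`. -/
theorem apply_three (B : IsRegularBox Φ z₀ r a₁ b₁) {z : ExtSpace} (hz : z ∈ Metric.ball z₀ r) :
    Φ z 3 * fderiv ℝ Φ z ![1, 0, 0, 0, 0] 0 = z 3 * fderiv ℝ Φ z ![0, 1, 0, 0, 0] 1 ^ 2 :=
  (B.fderiv_one_and_coefficient hz (Metric.mem_ball_self B.pos) (Metric.mem_ball_self B.pos)).2

/-- The derivative of the transformation rule for `D`. -/
theorem fderiv_three (B : IsRegularBox Φ z₀ r a₁ b₁) {z : ExtSpace} (hz : z ∈ Metric.ball z₀ r)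
    (v : ExtSpace) :
    fderiv ℝ Φ z v 3 * fderiv ℝ Φ z ![1, 0, 0, 0, 0] 0 +
        Φ z 3 * fderiv ℝ (fderiv ℝ Φ) z v ![1, 0, 0, 0, 0] 0 =
      v 3 * fderiv ℝ Φ z ![0, 1, 0, 0, 0] 1 ^ 2 +
        z 3 * (2 * fderiv ℝ Φ z ![0, 1, 0, 0, 0] 1 *
          fderiv ℝ (fderiv ℝ Φ) z v ![0, 1, 0, 0, 0] 1) := by
  have hΦ := B.contDiffAt hz
  have h1 := (hasFDerivAt_pi'.1 (hΦ.differentiableAt (by simp)).hasFDerivAt 3).mul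
    (hasFDerivAt_fderiv_apply hΦ ![1, 0, 0, 0, 0] 0)
  have h2 := ((ContinuousLinearMap.proj (R := ℝ) (φ := fun _ : Fin 5 => ℝ) 3).hasFDerivAt
    (x := z)).mul ((hasFDerivAt_fderiv_apply hΦ ![0, 1, 0, 0, 0] 1).pow 2)
  have h3 := congrArg (fun l => l v) (h1.unique (h2.congr_of_eventuallyEq
    (eventually_of_mem (Metric.isOpen_ball.mem_nhds hz) fun y hy => B.apply_three hy)))
  simp at h3
  linear_combination h3

theorem fderiv_nonzero (B : IsRegularBox Φ z₀ r a₁ b₁) {z : ExtSpace}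
    (hz : z ∈ Metric.ball z₀ r) {a b : ℝ} (ha : a ∈ Metric.ball a₁ r)
    (hb : b ∈ Metric.ball b₁ r) :
    fderiv ℝ Φ z ![1, 0, 0, 0, 0] 0 ≠ 0 ∧ fderiv ℝ Φ z ![0, 1, 0, 0, 0] 1 ≠ 0 ∧
      fderiv ℝ Φ z ![0, 0, 1, a, b] 2 ≠ 0 := by
  have hjac := B.jacobian z hz a ha b hb
  have h1 : fderiv ℝ Φ z ![0, 1, 0, 0, 0] 0 = 0 := B.fderiv_zero hz rfl
  have hu : fderiv ℝ Φ z ![0, 0, 1, a, b] 0 = 0 := B.fderiv_zero hz rfl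
  have hu1 : fderiv ℝ Φ z ![0, 0, 1, a, b] 1 = 0 := B.fderiv_one hz rfl rfl
  simpa [inducedJacobian, h1, hu, hu1] using hjac

end IsRegularBox

/-- Orders the second derivative along a purely spatial direction by powers of `p = w_x`, in
preparation for comparing coefficients. -/
theorem curveHessian_space {Φ : ExtSpace → ExtSpace} {z : ExtSpace} (hΦ : ContDiffAt ℝ ∞ Φ z)
    (a b c e η p : ℝ) :
    curveHessian Φ z a b c e 0 η (p * η) =
      η ^ 2 • (fderiv ℝ (fderiv ℝ Φ) z ![0, 1, 0, 0, 0] ![0, 1, 0, 0, 0] +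
        (2 * p) • fderiv ℝ (fderiv ℝ Φ) z ![0, 1, 0, 0, 0] ![0, 0, 1, a, b] +
        p ^ 2 • (fderiv ℝ (fderiv ℝ Φ) z ![0, 0, 1, a, b] ![0, 0, 1, a, b] +
          fderiv ℝ Φ z ![0, 0, 0, c, e])) := by
  rw [curveHessian, map_liftVector, map_liftVector (fderiv ℝ (fderiv ℝ Φ) z)]
  simp only [zero_smul, zero_add, add_apply, smul_apply]
  rw [fderiv_fderiv_symm hΦ ![0, 0, 1, a, b] ![0, 1, 0, 0, 0]]
  module

namespace IsRegularBox

variable {Φ : OpenPartialHomeomorph ExtSpace ExtSpace} {z₀ : ExtSpace} {r a₁ b₁ : ℝ}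

/-- `T_t` and `X_x` have no derivatives in `u`, `D`, `K`, so differentiating `D̃ T_t = D X_x²` along
the coefficients affects only `D̃` and `D`. -/
theorem fderiv_three_total (B : IsRegularBox Φ z₀ r a₁ b₁) {z : ExtSpace}
    (hz : z ∈ Metric.ball z₀ r) (a b : ℝ) :
    fderiv ℝ Φ z ![0, 0, 1, a, b] 3 * fderiv ℝ Φ z ![1, 0, 0, 0, 0] 0 =
      a * fderiv ℝ Φ z ![0, 1, 0, 0, 0] 1 ^ 2 := by
  have h := B.fderiv_three hz ![0, 0, 1, a, b]
  rw [fderiv_fderiv_symm (B.contDiffAt hz), B.fderiv_fderiv_zero hz rfl,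
    fderiv_fderiv_symm (B.contDiffAt hz) ![0, 0, 1, a, b], B.fderiv_fderiv_one hz rfl rfl] at h
  simpa using h

/-- The rule for `K` appears as an implication because its premises are proved later, from the first
and the last parts of this same statement. -/
theorem value_condition (B : IsRegularBox Φ z₀ r a₁ b₁) {z : ExtSpace}
    (hz : z ∈ Metric.ball z₀ r) {a b : ℝ} (ha : a ∈ Metric.ball a₁ r)
    (hb : b ∈ Metric.ball b₁ r) (c e : ℝ) :
    (fderiv ℝ (fderiv ℝ Φ) z ![0, 0, 1, a, b] ![0, 0, 1, a, b] +
      fderiv ℝ Φ z ![0, 0, 0, c, e]) 2 = 0 ∧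
    (fderiv ℝ Φ z ![0, 1, 0, 0, 0] 2 = 0 →
      fderiv ℝ (fderiv ℝ Φ) z ![0, 1, 0, 0, 0] ![0, 0, 1, a, b] 2 = 0 →
      fderiv ℝ (fderiv ℝ Φ) z ![0, 1, 0, 0, 0] ![0, 1, 0, 0, 0] 1 = 0 →
      Φ z 4 * fderiv ℝ Φ z ![1, 0, 0, 0, 0] 0 =
        z 4 * fderiv ℝ Φ z ![0, 1, 0, 0, 0] 1 - fderiv ℝ Φ z ![1, 0, 0, 0, 0] 1) ∧
    ∃ δ κ : ℝ,
      (fderiv ℝ Φ z ![1, 0, 0, 0, 0] 3 = δ * fderiv ℝ Φ z ![1, 0, 0, 0, 0] 2 ∧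
        fderiv ℝ Φ z ![0, 1, 0, 0, 0] 3 = δ * fderiv ℝ Φ z ![0, 1, 0, 0, 0] 2 ∧
        fderiv ℝ Φ z ![0, 0, 1, a, b] 3 = δ * fderiv ℝ Φ z ![0, 0, 1, a, b] 2) ∧
      (fderiv ℝ Φ z ![1, 0, 0, 0, 0] 4 = κ * fderiv ℝ Φ z ![1, 0, 0, 0, 0] 2 ∧
        fderiv ℝ Φ z ![0, 1, 0, 0, 0] 4 = κ * fderiv ℝ Φ z ![0, 1, 0, 0, 0] 2) := by
  obtain ⟨δ, κ, hf, ⟨hδ₀, hδ₁, hδ⟩, ⟨hκ₀, hκ₁, -⟩, hJ⟩ := B.equiv.exists_jet_condition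
    (B.subset hz) (B.slope a ha) rfl (B.jacobian z hz a ha b hb) rfl rfl rfl c e rfl
  obtain ⟨h00, h11, h22⟩ := B.fderiv_nonzero hz ha hb
  have h1 : fderiv ℝ Φ z ![0, 1, 0, 0, 0] 0 = 0 := B.fderiv_zero hz rfl
  have hu : fderiv ℝ Φ z ![0, 0, 1, a, b] 0 = 0 := B.fderiv_zero hz rfl
  have hu1 : fderiv ℝ Φ z ![0, 0, 1, a, b] 1 = 0 := B.fderiv_one hz rfl rfl
  have hc1 : fderiv ℝ Φ z ![0, 0, 0, c, e] 1 = 0 := B.fderiv_one hz rfl rfl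
  have h1u : fderiv ℝ (fderiv ℝ Φ) z ![0, 1, 0, 0, 0] ![0, 0, 1, a, b] 1 = 0 :=
    B.fderiv_fderiv_one hz rfl rfl _
  have huu : fderiv ℝ (fderiv ℝ Φ) z ![0, 0, 1, a, b] ![0, 0, 1, a, b] 1 = 0 :=
    B.fderiv_fderiv_one hz rfl rfl _
  set η := (fderiv ℝ Φ z ![0, 1, 0, 0, 0] 1)⁻¹ with hη
  have hη1 : η * fderiv ℝ Φ z ![0, 1, 0, 0, 0] 1 = 1 := inv_mul_cancel₀ h11
  have key := value_of_jet_condition (B.three_ne_zero hz) h00 h22 hη1 (B.apply_three hz)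
    (B.fderiv_three_total hz a b) hδ (k := z 4) (g := Φ z 4)
    (p₀₁ := fderiv ℝ Φ z ![1, 0, 0, 0, 0] 1) (p₀₂ := fderiv ℝ Φ z ![1, 0, 0, 0, 0] 2)
    (p₁₂ := fderiv ℝ Φ z ![0, 1, 0, 0, 0] 2)
    (x₁₁ := fderiv ℝ (fderiv ℝ Φ) z ![0, 1, 0, 0, 0] ![0, 1, 0, 0, 0] 1)
    (h₁₁ := fderiv ℝ (fderiv ℝ Φ) z ![0, 1, 0, 0, 0] ![0, 1, 0, 0, 0] 2)
    (h₁₂ := fderiv ℝ (fderiv ℝ Φ) z ![0, 1, 0, 0, 0] ![0, 0, 1, a, b] 2)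
    (h₂₂ := (fderiv ℝ (fderiv ℝ Φ) z ![0, 0, 1, a, b] ![0, 0, 1, a, b] +
      fderiv ℝ Φ z ![0, 0, 0, c, e]) 2) (by
    intro p ωt ωx hωt hωx
    -- Taking `m = r = 0` loses nothing needed here: only the dependence on `p` is compared, so `τ =
    -- a p² + K p`.
    have h := hJ (a * p ^ 2 + z 4 * p) p 0 0 0 η ωt ωx (by ring)
      (by simpa [h1, hu, hu1] using ⟨h00, h11⟩) (by simpa [hu, hu1] using hωt)
      (by simpa [h1, hu, hu1] using hωx) (by simp [h1, hu]) (by simpa [hu1] using hη1)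
    have hH0 := B.curveHessian_zero hz a b c e η (p * η)
    have hH1 : curveHessian Φ z a b c e 0 η (p * η) 1 = η ^ 2 *
        fderiv ℝ (fderiv ℝ Φ) z ![0, 1, 0, 0, 0] ![0, 1, 0, 0, 0] 1 := by
      simp [curveHessian_space (B.contDiffAt hz), h1u, huu, hc1]
    have hH2 : curveHessian Φ z a b c e 0 η (p * η) 2 = η ^ 2 *
        (fderiv ℝ (fderiv ℝ Φ) z ![0, 1, 0, 0, 0] ![0, 1, 0, 0, 0] 2 +
        2 * p * fderiv ℝ (fderiv ℝ Φ) z ![0, 1, 0, 0, 0] ![0, 0, 1, a, b] 2 +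
        p ^ 2 * (fderiv ℝ (fderiv ℝ Φ) z ![0, 0, 1, a, b] ![0, 0, 1, a, b] +
          fderiv ℝ Φ z ![0, 0, 0, c, e]) 2) := by
      rw [curveHessian_space (B.contDiffAt hz)]
      rfl
    simp only [mul_zero, zero_add, hH0, hH1, hH2, zero_mul, sub_zero, add_zero, ne_eq,
      OfNat.ofNat_ne_zero, not_false_eq_true, zero_pow] at h
    exact h)
  exact ⟨key.1, key.2, δ, κ, ⟨hδ₀, hδ₁, hδ⟩, hκ₀, hκ₁⟩

/-- The second derivatives `c`, `e` of the coefficients are free and enter the `p²`-condition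
linearly, multiplied by the derivatives of the new `u` in `D` and `K`. -/
theorem fderiv_two_coefficients (B : IsRegularBox Φ z₀ r a₁ b₁) {z : ExtSpace}
    (hz : z ∈ Metric.ball z₀ r) :
    fderiv ℝ Φ z ![0, 0, 0, 1, 0] 2 = 0 ∧ fderiv ℝ Φ z ![0, 0, 0, 0, 1] 2 = 0 := by
  have key (c e : ℝ) := (B.value_condition hz (Metric.mem_ball_self B.pos)
    (Metric.mem_ball_self B.pos) c e).1
  have h0 := key 0 0
  have hz0 : (![0, 0, 0, 0, 0] : ExtSpace) = 0 := by
    ext i; fin_cases i <;> rfl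
  rw [hz0, map_zero, add_zero] at h0
  have h1 := key 1 0
  have h2 := key 0 1
  rw [Pi.add_apply, h0, zero_add] at h1 h2
  exact ⟨h1, h2⟩

/-- The new `u` does not depend on `t` and `x`, hence neither do the new `D` and `K`. -/
theorem fderiv_base (B : IsRegularBox Φ z₀ r a₁ b₁) {z : ExtSpace} (hz : z ∈ Metric.ball z₀ r) :
    (fderiv ℝ Φ z ![1, 0, 0, 0, 0] 2 = 0 ∧ fderiv ℝ Φ z ![0, 1, 0, 0, 0] 2 = 0) ∧
    (fderiv ℝ Φ z ![1, 0, 0, 0, 0] 3 = 0 ∧ fderiv ℝ Φ z ![0, 1, 0, 0, 0] 3 = 0) ∧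
    (fderiv ℝ Φ z ![1, 0, 0, 0, 0] 4 = 0 ∧ fderiv ℝ Φ z ![0, 1, 0, 0, 0] 4 = 0) := by
  obtain ⟨hD, hK⟩ := B.fderiv_two_coefficients hz
  obtain ⟨h00, h11, h22⟩ := B.fderiv_nonzero hz (Metric.mem_ball_self B.pos)
    (Metric.mem_ball_self B.pos)
  obtain ⟨-, -, δ, κ, ⟨hδ₀, hδ₁, hδ⟩, hκ₀, hκ₁⟩ := B.value_condition hz
    (Metric.mem_ball_self B.pos) (Metric.mem_ball_self B.pos) 0 0
  -- Eliminating `δ` with the differentiated rule for `D` gives `D̃_v U_u T_t = a X_x² U_v`. Only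
  -- the explicit factor `a` depends on the slopes, because `U` does not depend on `D` and `K`;
  -- hence `X_x² U_v = 0`.
  have key {v : ExtSpace} (hv : ∀ a ∈ Metric.ball a₁ r, ∀ b ∈ Metric.ball b₁ r, ∃ δ,
      fderiv ℝ Φ z v 3 = δ * fderiv ℝ Φ z v 2 ∧
      fderiv ℝ Φ z ![0, 0, 1, a, b] 3 = δ * fderiv ℝ Φ z ![0, 0, 1, a, b] 2) :
      fderiv ℝ Φ z v 2 = 0 := by
    have h := (coeff_eq_zero_of_ball B.pos (a₁ := a₁) (b₁ := b₁)
      (x := fderiv ℝ Φ z v 3 * fderiv ℝ Φ z ![0, 0, 1, 0, 0] 2 * fderiv ℝ Φ z ![1, 0, 0, 0, 0] 0)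
      (y := -(fderiv ℝ Φ z ![0, 1, 0, 0, 0] 1 ^ 2 * fderiv ℝ Φ z v 2)) (w := 0)
      fun a ha b hb => by
        obtain ⟨δ, h1, h2⟩ := hv a ha b hb
        have h3 := B.fderiv_three_total hz a b
        have h4 : fderiv ℝ Φ z ![0, 0, 1, a, b] 2 = fderiv ℝ Φ z ![0, 0, 1, 0, 0] 2 := by
          simp [map_totalVector _ a b, hD, hK]
        rw [h4] at h2
        linear_combination fderiv ℝ Φ z ![0, 0, 1, 0, 0] 2 * fderiv ℝ Φ z ![1, 0, 0, 0, 0] 0 * h1 +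
          fderiv ℝ Φ z v 2 * h3 - fderiv ℝ Φ z v 2 * fderiv ℝ Φ z ![1, 0, 0, 0, 0] 0 * h2).2.1
    simpa [h11] using h
  have h0 : fderiv ℝ Φ z ![1, 0, 0, 0, 0] 2 = 0 := key fun a ha b hb => by
    obtain ⟨-, -, δ, κ, ⟨hδ₀, hδ₁, hδ⟩, -⟩ := B.value_condition hz ha hb 0 0
    exact ⟨δ, hδ₀, hδ⟩
  have h1 : fderiv ℝ Φ z ![0, 1, 0, 0, 0] 2 = 0 := key fun a ha b hb => by
    obtain ⟨-, -, δ, κ, ⟨hδ₀, hδ₁, hδ⟩, -⟩ := B.value_condition hz ha hb 0 0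
    exact ⟨δ, hδ₁, hδ⟩
  rw [h0, mul_zero] at hδ₀ hκ₀
  rw [h1, mul_zero] at hδ₁ hκ₁
  exact ⟨⟨h0, h1⟩, ⟨hδ₀, hδ₁⟩, hκ₀, hκ₁⟩

/-- The new `u` depends on `u` only. -/
theorem fderiv_two (B : IsRegularBox Φ z₀ r a₁ b₁) {z : ExtSpace} (hz : z ∈ Metric.ball z₀ r)
    {w : ExtSpace} (hw : w 2 = 0) : fderiv ℝ Φ z w 2 = 0 := by
  obtain ⟨hD, hK⟩ := B.fderiv_two_coefficients hz
  obtain ⟨h0, h1⟩ := (B.fderiv_base hz).1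
  rw [map_extVector]
  simp [hw, hD, hK, h0, h1]

theorem fderiv_fderiv_two (B : IsRegularBox Φ z₀ r a₁ b₁) {z : ExtSpace}
    (hz : z ∈ Metric.ball z₀ r) {w : ExtSpace} (hw : w 2 = 0) (v : ExtSpace) :
    fderiv ℝ (fderiv ℝ Φ) z v w 2 = 0 :=
  fderiv_fderiv_apply_eq_zero Metric.isOpen_ball B.contDiffOn
    (fun _ hy => B.fderiv_two hy hw) hz v

/-- The `x`-derivative of `D̃ T_t = D X_x²` reduces to `0 = 2 D X_x X_xx`. -/
theorem fderiv_fderiv_space_space (B : IsRegularBox Φ z₀ r a₁ b₁) {z : ExtSpace}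
    (hz : z ∈ Metric.ball z₀ r) :
    fderiv ℝ (fderiv ℝ Φ) z ![0, 1, 0, 0, 0] ![0, 1, 0, 0, 0] 1 = 0 := by
  have h := B.fderiv_three hz ![0, 1, 0, 0, 0]
  have h11 := (B.fderiv_nonzero hz (Metric.mem_ball_self B.pos) (Metric.mem_ball_self B.pos)).2.1
  rw [fderiv_fderiv_symm (B.contDiffAt hz), B.fderiv_fderiv_zero hz rfl,
    (B.fderiv_base hz).2.1.2] at h
  simpa [h11, B.three_ne_zero hz] using h

/-- The transformation rule for `K`. -/
theorem apply_four (B : IsRegularBox Φ z₀ r a₁ b₁) {z : ExtSpace} (hz : z ∈ Metric.ball z₀ r) :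
    Φ z 4 * fderiv ℝ Φ z ![1, 0, 0, 0, 0] 0 =
      z 4 * fderiv ℝ Φ z ![0, 1, 0, 0, 0] 1 - fderiv ℝ Φ z ![1, 0, 0, 0, 0] 1 := by
  refine (B.value_condition hz (Metric.mem_ball_self B.pos) (Metric.mem_ball_self B.pos) 0 0).2.1
    (B.fderiv_base hz).1.2 ?_ (B.fderiv_fderiv_space_space hz)
  rw [fderiv_fderiv_symm (B.contDiffAt hz)]
  exact B.fderiv_fderiv_two hz rfl _

/-- The derivative of the transformation rule for `K`. -/
theorem fderiv_four (B : IsRegularBox Φ z₀ r a₁ b₁) {z : ExtSpace} (hz : z ∈ Metric.ball z₀ r)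
    (v : ExtSpace) :
    fderiv ℝ Φ z v 4 * fderiv ℝ Φ z ![1, 0, 0, 0, 0] 0 +
        Φ z 4 * fderiv ℝ (fderiv ℝ Φ) z v ![1, 0, 0, 0, 0] 0 =
      v 4 * fderiv ℝ Φ z ![0, 1, 0, 0, 0] 1 +
        z 4 * fderiv ℝ (fderiv ℝ Φ) z v ![0, 1, 0, 0, 0] 1 -
        fderiv ℝ (fderiv ℝ Φ) z v ![1, 0, 0, 0, 0] 1 := by
  have hΦ := B.contDiffAt hz
  have h1 := (hasFDerivAt_pi'.1 (hΦ.differentiableAt (by simp)).hasFDerivAt 4).mul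
    (hasFDerivAt_fderiv_apply hΦ ![1, 0, 0, 0, 0] 0)
  have h2 := (((ContinuousLinearMap.proj (R := ℝ) (φ := fun _ : Fin 5 => ℝ) 4).hasFDerivAt
    (x := z)).mul (hasFDerivAt_fderiv_apply hΦ ![0, 1, 0, 0, 0] 1)).sub
    (hasFDerivAt_fderiv_apply hΦ ![1, 0, 0, 0, 0] 1)
  have h3 := congrArg (fun l => l v) (h1.unique (h2.congr_of_eventuallyEq
    (eventually_of_mem (Metric.isOpen_ball.mem_nhds hz) fun y hy => B.apply_four hy)))
  simp at h3
  linear_combination h3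

end IsRegularBox

/-! ### Integration to the seven-parameter form -/

/-- The transformations of the extended space with the parameters `ε₁, …, ε₇`, indexed from `0`. -/
noncomputable def equivalenceMap (ε : Fin 7 → ℝ) (z : ExtSpace) : ExtSpace :=
  ![z 0 * ε 3 ^ 2 * ε 4 + ε 0,
    z 1 * ε 3 + ε 6 * z 0 + ε 1,
    z 2 * ε 5 + ε 2,
    z 3 * (ε 4)⁻¹,
    z 4 * (ε 3)⁻¹ * (ε 4)⁻¹ - ε 6 * (ε 3 ^ 2)⁻¹ * (ε 4)⁻¹]

namespace IsRegularBox

variable {Φ : OpenPartialHomeomorph ExtSpace ExtSpace} {z₀ : ExtSpace} {r a₁ b₁ : ℝ}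

/-- The second derivatives of the new `t`, `x`, `u` vanish. -/
theorem fderiv_fderiv_eq_zero (B : IsRegularBox Φ z₀ r a₁ b₁) {z : ExtSpace}
    (hz : z ∈ Metric.ball z₀ r) (v : ExtSpace) :
    fderiv ℝ (fderiv ℝ Φ) z v ![1, 0, 0, 0, 0] 0 = 0 ∧
      fderiv ℝ (fderiv ℝ Φ) z v ![1, 0, 0, 0, 0] 1 = 0 ∧
      fderiv ℝ (fderiv ℝ Φ) z v ![0, 1, 0, 0, 0] 1 = 0 ∧
      fderiv ℝ (fderiv ℝ Φ) z v ![0, 0, 1, 0, 0] 2 = 0 := by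
  have hΦ := B.contDiffAt hz
  obtain ⟨-, ⟨h30, h31⟩, h40, h41⟩ := B.fderiv_base hz
  have hxx := B.fderiv_fderiv_space_space hz
  -- The order matters: `X_xt = 0` comes from the `x`-derivative of the rule for `K`, then `T_tt =
  -- 0` from the `t`-derivative of the rule for `D`, and then `X_tt = 0` from the `t`-derivative of
  -- the rule for `K`.
  have hxt : fderiv ℝ (fderiv ℝ Φ) z ![0, 1, 0, 0, 0] ![1, 0, 0, 0, 0] 1 = 0 := by
    have h := B.fderiv_four hz ![0, 1, 0, 0, 0]
    have h0 : fderiv ℝ (fderiv ℝ Φ) z ![0, 1, 0, 0, 0] ![1, 0, 0, 0, 0] 0 = 0 := by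
      rw [fderiv_fderiv_symm hΦ]; exact B.fderiv_fderiv_zero hz rfl _
    rw [h0, h41, hxx] at h
    simpa using h.symm
  have htx : fderiv ℝ (fderiv ℝ Φ) z ![1, 0, 0, 0, 0] ![0, 1, 0, 0, 0] 1 = 0 := by
    rw [fderiv_fderiv_symm hΦ, hxt]
  have htt0 : fderiv ℝ (fderiv ℝ Φ) z ![1, 0, 0, 0, 0] ![1, 0, 0, 0, 0] 0 = 0 := by
    have h := B.fderiv_three hz ![1, 0, 0, 0, 0]
    have h3 : Φ z 3 ≠ 0 := by
      intro h3
      have h := B.apply_three hz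
      have h11 := (B.fderiv_nonzero hz (Metric.mem_ball_self B.pos)
        (Metric.mem_ball_self B.pos)).2.1
      rw [h3, zero_mul] at h
      exact mul_ne_zero (B.three_ne_zero hz) (pow_ne_zero 2 h11) h.symm
    rw [h30, htx] at h
    simpa [h3] using h
  have htt1 : fderiv ℝ (fderiv ℝ Φ) z ![1, 0, 0, 0, 0] ![1, 0, 0, 0, 0] 1 = 0 := by
    have h := B.fderiv_four hz ![1, 0, 0, 0, 0]
    rw [htt0, h40, htx] at h
    simpa using h.symm
  have huu : fderiv ℝ (fderiv ℝ Φ) z ![0, 0, 1, 0, 0] ![0, 0, 1, 0, 0] 2 = 0 := by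
    have h := (B.value_condition hz (Metric.mem_ball_self B.pos)
      (Metric.mem_ball_self B.pos) 0 0).1
    have h1 : fderiv ℝ Φ z ![0, 0, 0, 0, 0] 2 = 0 := B.fderiv_two hz rfl
    rw [Pi.add_apply, h1, add_zero, map_totalVector] at h
    have h2 (v : ExtSpace) : fderiv ℝ (fderiv ℝ Φ) z v ![0, 0, 0, 1, 0] 2 = 0 :=
      B.fderiv_fderiv_two hz rfl v
    have h3 (v : ExtSpace) : fderiv ℝ (fderiv ℝ Φ) z v ![0, 0, 0, 0, 1] 2 = 0 :=
      B.fderiv_fderiv_two hz rfl v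
    simp only [Pi.add_apply, Pi.smul_apply, h2, h3, smul_zero, add_zero] at h
    rw [fderiv_fderiv_symm hΦ, map_totalVector] at h
    simpa only [Pi.add_apply, Pi.smul_apply, h2, h3, smul_zero, add_zero] using h
  have h0 (w : ExtSpace) {j : ExtSpace} (hj : j 0 = 0) := B.fderiv_fderiv_zero hz hj w
  have h1 (w : ExtSpace) {j : ExtSpace} (hj : j 0 = 0) (hj' : j 1 = 0) :=
    B.fderiv_fderiv_one hz hj hj' w
  have h2 (w : ExtSpace) {j : ExtSpace} (hj : j 2 = 0) := B.fderiv_fderiv_two hz hj w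
  refine ⟨?_, ?_, ?_, ?_⟩ <;> rw [fderiv_fderiv_symm hΦ, map_extVector] <;>
    simp only [Pi.add_apply, Pi.smul_apply, smul_eq_mul]
  · rw [htt0, h0 _ rfl, h0 _ rfl, h0 _ rfl, h0 _ rfl]; ring
  · rw [htt1, htx, h1 _ rfl rfl, h1 _ rfl rfl, h1 _ rfl rfl]; ring
  · rw [hxt, hxx, h1 _ rfl rfl, h1 _ rfl rfl, h1 _ rfl rfl]; ring
  · rw [huu, h2 _ rfl, h2 _ rfl, h2 _ rfl, h2 _ rfl]; ring

/-- On the convex box vanishing second derivatives make `T`, `X`, `U` affine; the rules for `D` and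
`K` then have constant coefficients and determine the last two components. -/
theorem eq_equivalenceMap (B : IsRegularBox Φ z₀ r a₁ b₁) :
    ∃ ε : Fin 7 → ℝ, ε 3 * ε 4 * ε 5 ≠ 0 ∧
      ∀ z ∈ Metric.ball z₀ r, Φ z = equivalenceMap ε z := by
  have hz₀ : z₀ ∈ Metric.ball z₀ r := Metric.mem_ball_self B.pos
  have hpre : IsPreconnected (Metric.ball z₀ r) := (convex_ball z₀ r).isPreconnected
  have hconst (w : ExtSpace) (i : Fin 5)
      (h : ∀ z ∈ Metric.ball z₀ r, ∀ v, fderiv ℝ (fderiv ℝ Φ) z v w i = 0)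
      {z : ExtSpace} (hz : z ∈ Metric.ball z₀ r) : fderiv ℝ Φ z w i = fderiv ℝ Φ z₀ w i :=
    eq_of_fderiv_eq_zero Metric.isOpen_ball hpre (fun y hy =>
      (hasFDerivAt_fderiv_apply (B.contDiffAt hy) w i).congr_fderiv
        (by ext v; simpa using h y hy v)) hz hz₀
  have hT {z : ExtSpace} := hconst (z := z) ![1, 0, 0, 0, 0] 0
    fun z hz v => (B.fderiv_fderiv_eq_zero hz v).1
  have hXt {z : ExtSpace} := hconst (z := z) ![1, 0, 0, 0, 0] 1
    fun z hz v => (B.fderiv_fderiv_eq_zero hz v).2.1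
  have hX {z : ExtSpace} := hconst (z := z) ![0, 1, 0, 0, 0] 1
    fun z hz v => (B.fderiv_fderiv_eq_zero hz v).2.2.1
  have hU {z : ExtSpace} := hconst (z := z) ![0, 0, 1, 0, 0] 2
    fun z hz v => (B.fderiv_fderiv_eq_zero hz v).2.2.2
  obtain ⟨hθ, hα, hμ⟩ := B.fderiv_nonzero hz₀ (Metric.mem_ball_self B.pos)
    (Metric.mem_ball_self B.pos)
  have hμ' : fderiv ℝ Φ z₀ ![0, 0, 1, 0, 0] 2 ≠ 0 := by
    obtain ⟨hD, hK⟩ := B.fderiv_two_coefficients hz₀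
    simpa [map_totalVector _ a₁ b₁, hD, hK] using hμ
  have h3 {z : ExtSpace} (hz : z ∈ Metric.ball z₀ r) := B.apply_three hz
  have h4 {z : ExtSpace} (hz : z ∈ Metric.ball z₀ r) := B.apply_four hz
  set θ := fderiv ℝ Φ z₀ ![1, 0, 0, 0, 0] 0
  set α := fderiv ℝ Φ z₀ ![0, 1, 0, 0, 0] 1
  set β := fderiv ℝ Φ z₀ ![1, 0, 0, 0, 0] 1
  set μ := fderiv ℝ Φ z₀ ![0, 0, 1, 0, 0] 2
  have haff (i : Fin 5) (l : ExtSpace →L[ℝ] ℝ)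
      (hl : ∀ z ∈ Metric.ball z₀ r, ∀ v, fderiv ℝ Φ z v i = l v) {z : ExtSpace}
      (hz : z ∈ Metric.ball z₀ r) : Φ z i = l z + (Φ z₀ i - l z₀) := by
    have := eq_of_fderiv_eq_zero (f := fun z => Φ z i - l z) Metric.isOpen_ball hpre
      (fun y hy => ((hasFDerivAt_pi'.1
        ((B.contDiffAt hy).differentiableAt (by simp)).hasFDerivAt i).sub
        l.hasFDerivAt).congr_fderiv (by ext v; simpa [sub_eq_zero] using hl y hy v)) hz hz₀
    linear_combination this
  let π : Fin 5 → ExtSpace →L[ℝ] ℝ := fun i => ContinuousLinearMap.proj i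
  have e0 {z : ExtSpace} (hz : z ∈ Metric.ball z₀ r) := haff 0 (θ • π 0) (fun z hz v => by
    rw [map_extVector]
    simp only [Pi.add_apply, Pi.smul_apply, smul_eq_mul]
    rw [hT hz, B.fderiv_zero hz rfl, B.fderiv_zero hz rfl, B.fderiv_zero hz rfl,
      B.fderiv_zero hz rfl]
    simp [π, mul_comm]) hz
  have e1 {z : ExtSpace} (hz : z ∈ Metric.ball z₀ r) := haff 1 (β • π 0 + α • π 1)
    (fun z hz v => by
    rw [map_extVector]
    simp only [Pi.add_apply, Pi.smul_apply, smul_eq_mul]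
    rw [hX hz, hXt hz, B.fderiv_one hz rfl rfl, B.fderiv_one hz rfl rfl, B.fderiv_one hz rfl rfl]
    simp [π, mul_comm]) hz
  have e2 {z : ExtSpace} (hz : z ∈ Metric.ball z₀ r) := haff 2 (μ • π 2) (fun z hz v => by
    rw [map_extVector]
    simp only [Pi.add_apply, Pi.smul_apply, smul_eq_mul]
    rw [hU hz, B.fderiv_two hz rfl, B.fderiv_two hz rfl, B.fderiv_two hz rfl, B.fderiv_two hz rfl]
    simp [π, mul_comm]) hz
  -- With `α = X_x` as the scale of `x`, the relation `T_t = θ = α² ε₅` dictates `ε₅ = θ / α²`; the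
  -- factor of `t` in the new `x` is `β = X_t`.
  refine ⟨![Φ z₀ 0 - θ * z₀ 0, Φ z₀ 1 - (β * z₀ 0 + α * z₀ 1), Φ z₀ 2 - μ * z₀ 2, α, θ / α ^ 2,
    μ, β], ?_, fun z hz => ?_⟩
  · simpa using ⟨⟨hα, hθ, hα⟩, hμ'⟩
  have h3' := h3 hz
  have h4' := h4 hz
  rw [hT hz, hX hz] at h3' h4'
  rw [hXt hz] at h4'
  have e0' := e0 hz
  have e1' := e1 hz
  have e2' := e2 hz
  simp [π] at e0' e1' e2'
  have f3 : Φ z 3 = z 3 * (θ / α ^ 2)⁻¹ := by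
    field_simp; linear_combination h3'
  have f4 : Φ z 4 = z 4 * α⁻¹ * (θ / α ^ 2)⁻¹ - β * (α ^ 2)⁻¹ * (θ / α ^ 2)⁻¹ := by
    field_simp; linear_combination h4'
  ext i
  fin_cases i
  · simp [equivalenceMap, e0']; field_simp
  · simp [equivalenceMap, e1']; ring
  · simp [equivalenceMap, e2']; ring
  · simpa [equivalenceMap] using f3
  · simpa [equivalenceMap] using f4

end IsRegularBox

/-! ### Globalization on connected sets -/

/-- Identity principle: a function that belongs locally to a family of analytic functions belongs
to it globally. -/
theorem exists_eqOn_of_locally_analytic {ι E F : Type*} [NormedAddCommGroup E] [NormedSpace ℝ E]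
    [NormedAddCommGroup F] [NormedSpace ℝ F] {S : Set E} (hS : IsPreconnected S)
    (hne : S.Nonempty) {f : E → F} {G : ι → E → F} {p : ι → Prop}
    (hG : ∀ i, AnalyticOnNhd ℝ (G i) univ) (h : ∀ z ∈ S, ∃ i, p i ∧ f =ᶠ[𝓝 z] G i) :
    ∃ i, p i ∧ EqOn f (G i) S := by
  obtain ⟨x, hx⟩ := hne
  obtain ⟨i, hi, hfi⟩ := h x hx
  refine ⟨i, hi, fun y hy => ?_⟩
  -- Having the same family members as germs is an equivalence relation on points. It is locally
  -- constant: two members whose germs agree with `f` at one point coincide everywhere.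
  have key := hS.induction₂ (fun x y => ∀ j, f =ᶠ[𝓝 x] G j ↔ f =ᶠ[𝓝 y] G j) (fun x hx => ?_)
    (fun x y z _ _ _ h1 h2 j => (h1 j).trans (h2 j)) (fun x y _ _ h j => (h j).symm) hx hy
  · exact ((key i).1 hfi).self_of_nhds
  · obtain ⟨k, -, hk⟩ := h x hx
    have hev : ∀ᶠ y in 𝓝 x, f =ᶠ[𝓝 y] G k := eventually_eventually_nhds.2 hk
    filter_upwards [hev.filter_mono nhdsWithin_le_nhds] with y hky j
    constructor
    · intro hj
      rwa [(hG j).eq_of_eventuallyEq (hG k) (hj.symm.trans hk)]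
    · intro hj
      rwa [(hG j).eq_of_eventuallyEq (hG k) (hj.symm.trans hky)]

theorem analyticOnNhd_equivalenceMap (ε : Fin 7 → ℝ) :
    AnalyticOnNhd ℝ (equivalenceMap ε) univ := by
  rw [← contDiff_omega_iff_analyticOnNhd, contDiff_pi]
  intro i
  fin_cases i <;> simp [equivalenceMap] <;> fun_prop

theorem contDiff_equivalenceMap (ε : Fin 7 → ℝ) : ContDiff ℝ ∞ (equivalenceMap ε) := by
  rw [contDiff_pi]
  intro i
  fin_cases i <;> simp [equivalenceMap] <;> fun_prop

theorem IsEquivalenceTransformation.exists_eqOn_equivalenceMap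
    {Φ : OpenPartialHomeomorph ExtSpace ExtSpace} (h : IsEquivalenceTransformation Φ)
    {S : Set ExtSpace} (hS : IsPreconnected S) (hsub : S ⊆ Φ.source) :
    ∃ ε : Fin 7 → ℝ, ε 3 * ε 4 * ε 5 ≠ 0 ∧ EqOn Φ (equivalenceMap ε) S := by
  rcases S.eq_empty_or_nonempty with rfl | hne
  · exact ⟨fun _ => 1, by simp, eqOn_empty _ _⟩
  · refine exists_eqOn_of_locally_analytic hS hne analyticOnNhd_equivalenceMap fun z hz => ?_
    obtain ⟨r, a₁, b₁, B⟩ := h.exists_regularBox (hsub hz)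
    obtain ⟨ε, hε, hΦ⟩ := B.eq_equivalenceMap
    exact ⟨ε, hε, eventually_of_mem (Metric.ball_mem_nhds z B.pos) hΦ⟩

/-! ### Members of the family are equivalence transformations -/

/-- The parameters of the inverse transformation. -/
noncomputable def inverseParameters (ε : Fin 7 → ℝ) : Fin 7 → ℝ :=
  ![-ε 0 * (ε 3 ^ 2 * ε 4)⁻¹, ε 6 * ε 0 * (ε 3 ^ 3 * ε 4)⁻¹ - ε 1 * (ε 3)⁻¹, -ε 2 * (ε 5)⁻¹,
    (ε 3)⁻¹, (ε 4)⁻¹, (ε 5)⁻¹, -ε 6 * (ε 3 ^ 3 * ε 4)⁻¹]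

theorem equivalenceMap_inverse_left {ε : Fin 7 → ℝ} (hε : ε 3 * ε 4 * ε 5 ≠ 0) (z : ExtSpace) :
    equivalenceMap (inverseParameters ε) (equivalenceMap ε z) = z := by
  have h5 := right_ne_zero_of_mul hε
  have h4 := right_ne_zero_of_mul (left_ne_zero_of_mul hε)
  have h3 := left_ne_zero_of_mul (left_ne_zero_of_mul hε)
  ext i
  fin_cases i <;> simp [equivalenceMap, inverseParameters] <;> field_simp <;> ring

theorem equivalenceMap_inverse_right {ε : Fin 7 → ℝ} (hε : ε 3 * ε 4 * ε 5 ≠ 0) (z : ExtSpace) :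
    equivalenceMap ε (equivalenceMap (inverseParameters ε) z) = z := by
  have h5 := right_ne_zero_of_mul hε
  have h4 := right_ne_zero_of_mul (left_ne_zero_of_mul hε)
  have h3 := left_ne_zero_of_mul (left_ne_zero_of_mul hε)
  ext i
  fin_cases i <;> simp [equivalenceMap, inverseParameters] <;> field_simp <;> ring

/-- The transformation with the parameters `ε` as a homeomorphism. -/
noncomputable def equivalenceHomeomorph (ε : Fin 7 → ℝ) (hε : ε 3 * ε 4 * ε 5 ≠ 0) :
    ExtSpace ≃ₜ ExtSpace where
  toFun := equivalenceMap ε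
  invFun := equivalenceMap (inverseParameters ε)
  left_inv := equivalenceMap_inverse_left hε
  right_inv := equivalenceMap_inverse_right hε
  continuous_toFun := (contDiff_equivalenceMap _).continuous
  continuous_invFun := (contDiff_equivalenceMap _).continuous

/-- The linear part of `equivalenceMap ε`. -/
noncomputable def equivalenceDeriv (ε : Fin 7 → ℝ) : ExtSpace →L[ℝ] ExtSpace :=
  ContinuousLinearMap.pi ![(ε 3 ^ 2 * ε 4) • ContinuousLinearMap.proj 0,
    ε 3 • ContinuousLinearMap.proj 1 + ε 6 • ContinuousLinearMap.proj 0,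
    ε 5 • ContinuousLinearMap.proj 2, (ε 4)⁻¹ • ContinuousLinearMap.proj 3,
    ((ε 3)⁻¹ * (ε 4)⁻¹) • ContinuousLinearMap.proj 4]

theorem hasFDerivAt_equivalenceMap (ε : Fin 7 → ℝ) (z : ExtSpace) :
    HasFDerivAt (equivalenceMap ε) (equivalenceDeriv ε) z := by
  have h : equivalenceMap ε = fun z => equivalenceDeriv ε z +
      ![ε 0, ε 1, ε 2, 0, -(ε 6 * (ε 3 ^ 2)⁻¹ * (ε 4)⁻¹)] := by
    funext z i
    fin_cases i <;> simp [equivalenceMap, equivalenceDeriv] <;> ring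
  rw [h]
  exact (equivalenceDeriv ε).hasFDerivAt.add_const _

/-- The first two derivatives after an affine change of variables. -/
theorem deriv_affine_change {f g : ℝ → ℝ} {y m c n k : ℝ}
    (hf : ContDiffAt ℝ 2 f (y * m + c)) (hg : ∀ᶠ x in 𝓝 y, f (x * m + c) = g x * k + n)
    (hk : k ≠ 0) :
    deriv g y = m / k * deriv f (y * m + c) ∧
      deriv (deriv g) y = m ^ 2 / k * deriv (deriv f) (y * m + c) := by
  have hlin (x : ℝ) : HasDerivAt (fun x => x * m + c) m x := by
    simpa using ((hasDerivAt_id x).mul_const m).add_const c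
  have hg' : g =ᶠ[𝓝 y] fun x => (f (x * m + c) - n) / k := by
    filter_upwards [hg] with x hx
    rw [hx]; field_simp; ring
  have hf' : ∀ᶠ x in 𝓝 y, ContDiffAt ℝ 2 f (x * m + c) :=
    (hlin y).continuousAt.eventually (hf.eventually (by simp))
  have h1 : deriv g =ᶠ[𝓝 y] fun x => m / k * deriv f (x * m + c) := by
    filter_upwards [hg'.deriv, hf'] with x hx hfx
    rw [hx]
    exact ((((hfx.differentiableAt (by simp)).hasDerivAt.comp x (hlin x)).sub_const n).div_const
      k).deriv.trans (by ring)
  refine ⟨h1.self_of_nhds, ?_⟩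
  have h2 : DifferentiableAt ℝ (deriv f) (y * m + c) :=
    (hf.derivWithin (m := 1) (by norm_num)).differentiableAt (by simp)
  rw [h1.deriv_eq]
  exact ((h2.hasDerivAt.comp y (hlin y)).const_mul (m / k)).deriv.trans (by ring)

/-- The transformed arbitrary element `D`. -/
noncomputable def transformedD (ε : Fin 7 → ℝ) (D : ℝ → ℝ) (v : ℝ) : ℝ :=
  D ((v - ε 2) / ε 5) * (ε 4)⁻¹

/-- The transformed arbitrary element `K`. -/
noncomputable def transformedK (ε : Fin 7 → ℝ) (K : ℝ → ℝ) (v : ℝ) : ℝ :=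
  K ((v - ε 2) / ε 5) * (ε 3)⁻¹ * (ε 4)⁻¹ - ε 6 * (ε 3 ^ 2)⁻¹ * (ε 4)⁻¹

theorem sub_div_cancel_affine {u m n : ℝ} (hm : m ≠ 0) : (u * m + n - n) / m = u := by
  field_simp; ring

theorem hasDerivAt_comp_sub_div {f : ℝ → ℝ} {u m n : ℝ} (hm : m ≠ 0)
    (hf : DifferentiableAt ℝ f u) :
    HasDerivAt (fun v => f ((v - n) / m)) (deriv f u * (1 / m)) (u * m + n) := by
  have h1 : HasDerivAt (fun v : ℝ => (v - n) / m) (1 / m) (u * m + n) :=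
    ((hasDerivAt_id _).sub_const n).div_const m
  have h2 : HasDerivAt f (deriv f u) ((u * m + n - n) / m) := by
    rw [sub_div_cancel_affine hm]; exact hf.hasDerivAt
  exact HasDerivAt.comp (h₂ := f) (h := fun v => (v - n) / m) _ h2 h1

theorem hasDerivAt_transformedD {ε : Fin 7 → ℝ} (hε : ε 5 ≠ 0) {D : ℝ → ℝ} {u : ℝ}
    (hD : DifferentiableAt ℝ D u) :
    HasDerivAt (transformedD ε D) (deriv D u * (1 / ε 5) * (ε 4)⁻¹) (u * ε 5 + ε 2) :=
  (hasDerivAt_comp_sub_div hε hD).mul_const _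

theorem hasDerivAt_transformedK {ε : Fin 7 → ℝ} (hε : ε 5 ≠ 0) {K : ℝ → ℝ} {u : ℝ}
    (hK : DifferentiableAt ℝ K u) :
    HasDerivAt (transformedK ε K) (deriv K u * (1 / ε 5) * (ε 3)⁻¹ * (ε 4)⁻¹) (u * ε 5 + ε 2) :=
  (((hasDerivAt_comp_sub_div hε hK).mul_const _).mul_const _).sub_const _

theorem IsArbitraryElementAt.transformed {ε : Fin 7 → ℝ} (hε : ε 3 * ε 4 * ε 5 ≠ 0)
    {D K : ℝ → ℝ} {u₀ : ℝ} (h : IsArbitraryElementAt D K u₀) :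
    IsArbitraryElementAt (transformedD ε D) (transformedK ε K) (u₀ * ε 5 + ε 2) := by
  have h5 := right_ne_zero_of_mul hε
  have h4 := right_ne_zero_of_mul (left_ne_zero_of_mul hε)
  have h3 := left_ne_zero_of_mul (left_ne_zero_of_mul hε)
  have ht : Tendsto (fun v => (v - ε 2) / ε 5) (𝓝 (u₀ * ε 5 + ε 2)) (𝓝 u₀) := by
    have : ContinuousAt (fun v => (v - ε 2) / ε 5) (u₀ * ε 5 + ε 2) := by fun_prop
    simpa [ContinuousAt, h5] using this
  have hsm {f : ℝ → ℝ} {v : ℝ} (hf : ContDiffAt ℝ ∞ f ((v - ε 2) / ε 5)) :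
      ContDiffAt ℝ ∞ (fun v => f ((v - ε 2) / ε 5)) v :=
    hf.comp v (by fun_prop)
  refine ⟨?_, ?_, ?_, fun hlin => ?_⟩
  · filter_upwards [ht.eventually h.smooth_D] with v hv
    exact (hsm hv).mul contDiffAt_const
  · filter_upwards [ht.eventually h.smooth_K] with v hv
    exact (((hsm hv).mul contDiffAt_const).mul contDiffAt_const).sub contDiffAt_const
  · simp only [transformedD, sub_div_cancel_affine h5]
    exact mul_ne_zero h.ne_zero (inv_ne_zero h4)
  · refine h.nonlinear ?_
    have ht' : Tendsto (fun u => u * ε 5 + ε 2) (𝓝 u₀) (𝓝 (u₀ * ε 5 + ε 2)) :=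
      (by fun_prop : Continuous fun u => u * ε 5 + ε 2).continuousAt
    filter_upwards [h.smooth_D, h.smooth_K, ht'.eventually hlin] with u hD hK hu
    rw [(hasDerivAt_transformedD h5 (hD.differentiableAt (by simp))).deriv,
      (hasDerivAt_transformedK h5 (hK.differentiableAt (by simp))).deriv] at hu
    simpa [h3, h4, h5] using hu

/-- With `w' = ω`, the chain rule gives `ε₆ w_t = ε₄² ε₅ ω_t + ε₇ ω_x`, `ε₆ w_x = ε₄ ω_x` and `ε₆
w_xx = ε₄² ω_xx`. The equations agree up to the nonzero factor `ε₄² ε₅ / ε₆`, the Galilean term `ε₇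
ω_x` being absorbed by the shift of `K`. -/
theorem carriesEquationAt_of_eventuallyEq {ε : Fin 7 → ℝ} (hε : ε 3 * ε 4 * ε 5 ≠ 0)
    {φ : BaseSpace → BaseSpace} {D K : ℝ → ℝ} {q : BaseSpace}
    (hφ : ∀ᶠ y in 𝓝 q, φ y = ![y 0 * ε 3 ^ 2 * ε 4 + ε 0, y 1 * ε 3 + ε 6 * y 0 + ε 1,
      y 2 * ε 5 + ε 2]) (hD : DifferentiableAt ℝ D (q 2)) :
    CarriesEquationAt φ D K (transformedD ε D) (transformedK ε K) q := by
  have h5 := right_ne_zero_of_mul hε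
  have h4 := right_ne_zero_of_mul (left_ne_zero_of_mul hε)
  have h3 := left_ne_zero_of_mul (left_ne_zero_of_mul hε)
  intro w w' hw hwq hw' hgraph
  have hφq := hφ.self_of_nhds
  have hq0 : φ q 0 = q 0 * ε 3 ^ 2 * ε 4 + ε 0 := by rw [hφq]; rfl
  have hq1 : φ q 1 = q 1 * ε 3 + (ε 6 * q 0 + ε 1) := by rw [hφq]; simp; ring
  set T := φ q 0
  set X := φ q 1
  have hqe : (![q 0, q 1, w (q 0) (q 1)] : BaseSpace) = q := by
    rw [hwq]; ext i; fin_cases i <;> rfl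
  have hcont : Tendsto (fun s : ℝ × ℝ => (![s.1, s.2, w s.1 s.2] : BaseSpace))
      (𝓝 (q 0, q 1)) (𝓝 q) := by
    have : ContinuousAt (fun s : ℝ × ℝ => (![s.1, s.2, w s.1 s.2] : BaseSpace)) (q 0, q 1) := by
      refine continuousAt_pi.2 fun i => ?_
      fin_cases i
      · exact continuousAt_fst
      · exact continuousAt_snd
      · exact hw.continuousAt
    simpa [ContinuousAt, hqe] using this
  have hrel : ∀ᶠ s : ℝ × ℝ in 𝓝 (q 0, q 1), w' (s.1 * ε 3 ^ 2 * ε 4 + ε 0)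
      (s.2 * ε 3 + ε 6 * s.1 + ε 1) = w s.1 s.2 * ε 5 + ε 2 := by
    filter_upwards [hgraph, hcont.eventually hφ] with s hs hs'
    rw [hs'] at hs
    simpa using hs
  have hwT : w' T X = q 2 * ε 5 + ε 2 := by
    have := hrel.self_of_nhds
    rw [hwq] at this
    rw [hq0, hq1, ← this]
    simp only [add_assoc]
  have hw'x : ContDiffAt ℝ 2 (w' T) X :=
    ContDiffAt.comp (g := fun s : ℝ × ℝ => w' s.1 s.2) (f := fun y : ℝ => (T, y)) X
      (hw'.of_le two_le_smooth) (by fun_prop)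
  have hwx : ContDiffAt ℝ 2 (w (q 0)) (q 1) :=
    ContDiffAt.comp (g := fun s : ℝ × ℝ => w s.1 s.2) (f := fun y : ℝ => (q 0, y)) (q 1)
      (hw.of_le two_le_smooth) (by fun_prop)
  have hx : ∀ᶠ y in 𝓝 (q 1), w' T (y * ε 3 + (ε 6 * q 0 + ε 1)) = w (q 0) y * ε 5 + ε 2 := by
    have : Tendsto (fun y : ℝ => (q 0, y)) (𝓝 (q 1)) (𝓝 (q 0, q 1)) :=
      (by fun_prop : Continuous fun y : ℝ => (q 0, y)).continuousAt
    filter_upwards [this.eventually hrel] with y hy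
    rw [hq0, ← hy, add_assoc]
  obtain ⟨hdx, hdxx⟩ := deriv_affine_change (by rw [← hq1]; exact hw'x) hx h5
  rw [← hq1] at hdx hdxx
  have hdt : deriv (fun s => w s (q 1)) (q 0) = (ε 3 ^ 2 * ε 4 / ε 5) * deriv (fun s => w' s X) T +
      ε 6 / ε 5 * deriv (w' T) X := by
    have hWd : HasFDerivAt (fun s : ℝ × ℝ => w' s.1 s.2)
        (fderiv ℝ (fun s : ℝ × ℝ => w' s.1 s.2) (T, X)) (T, X) :=
      (hw'.differentiableAt (by simp)).hasFDerivAt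
    have h1 : deriv (fun s => w' s X) T = fderiv ℝ (fun s : ℝ × ℝ => w' s.1 s.2) (T, X) (1, 0) :=
      (hWd.comp_hasDerivAt (f := fun s => (s, X)) T
        ((hasDerivAt_id T).prodMk (hasDerivAt_const T X))).deriv
    have h2 : deriv (w' T) X = fderiv ℝ (fun s : ℝ × ℝ => w' s.1 s.2) (T, X) (0, 1) :=
      (hWd.comp_hasDerivAt (f := fun y => (T, y)) X
        ((hasDerivAt_const X T).prodMk (hasDerivAt_id X))).deriv
    have ht : (fun s => w s (q 1)) =ᶠ[𝓝 (q 0)] fun s => (w' (s * ε 3 ^ 2 * ε 4 + ε 0)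
        (q 1 * ε 3 + ε 6 * s + ε 1) - ε 2) / ε 5 := by
      have : Tendsto (fun s : ℝ => (s, q 1)) (𝓝 (q 0)) (𝓝 (q 0, q 1)) :=
        (by fun_prop : Continuous fun s : ℝ => (s, q 1)).continuousAt
      filter_upwards [this.eventually hrel] with s hs
      rw [hs]; field_simp; ring
    have hγ : HasDerivAt (fun s : ℝ => (s * ε 3 ^ 2 * ε 4 + ε 0, q 1 * ε 3 + ε 6 * s + ε 1))
        (ε 3 ^ 2 * ε 4, ε 6) (q 0) := by
      refine HasDerivAt.prodMk ?_ ?_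
      · simpa using (((hasDerivAt_id (q 0)).mul_const (ε 3 ^ 2)).mul_const (ε 4)).add_const (ε 0)
      · simpa using (((hasDerivAt_id (q 0)).const_mul (ε 6)).const_add (q 1 * ε 3)).add_const (ε 1)
    have hWd' : HasFDerivAt (fun s : ℝ × ℝ => w' s.1 s.2)
        (fderiv ℝ (fun s : ℝ × ℝ => w' s.1 s.2) (T, X))
        (q 0 * ε 3 ^ 2 * ε 4 + ε 0, q 1 * ε 3 + ε 6 * q 0 + ε 1) := by
      rw [add_assoc (q 1 * ε 3), ← hq0, ← hq1]; exact hWd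
    have h3 := ((hWd'.comp_hasDerivAt (q 0) hγ).sub_const (ε 2)).div_const (ε 5)
    have h4 : ((ε 3 ^ 2 * ε 4, ε 6) : ℝ × ℝ) = (ε 3 ^ 2 * ε 4) • (1, 0) + ε 6 • (0, 1) := by simp
    rw [h4, map_add, map_smul, map_smul, ← h1, ← h2] at h3
    rw [ht.deriv_eq]
    refine h3.deriv.trans ?_
    simp only [smul_eq_mul]; ring
  have hD' := hasDerivAt_transformedD (ε := ε) h5 hD
  rw [satisfiesAt_iff hwx (by rwa [hwq]),
    satisfiesAt_iff hw'x (by rw [hwT]; exact hD'.differentiableAt), hwT, hwq, hD'.deriv, hdx, hdxx,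
    hdt]
  simp only [transformedD, transformedK, sub_div_cancel_affine h5]
  generalize deriv (fun s => w' s X) T = ωt
  generalize deriv (w' T) X = ωx
  generalize deriv (deriv (w' T)) X = ωxx
  constructor
  · intro h
    field_simp at h ⊢
    linear_combination h
  · intro h
    field_simp at h ⊢
    linear_combination h

theorem isEquivalenceTransformation_of_eqOn {Φ : OpenPartialHomeomorph ExtSpace ExtSpace}
    (hsub : Φ.source ⊆ diffusiveRegion) {ε : Fin 7 → ℝ} (hε : ε 3 * ε 4 * ε 5 ≠ 0)
    (hΦ : EqOn Φ (equivalenceMap ε) Φ.source) : IsEquivalenceTransformation Φ := by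
  have h5 := right_ne_zero_of_mul hε
  have h4 := right_ne_zero_of_mul (left_ne_zero_of_mul hε)
  have h3 := left_ne_zero_of_mul (left_ne_zero_of_mul hε)
  refine ⟨hsub, (contDiff_equivalenceMap ε).contDiffOn.congr hΦ, ?_, ?_, ?_⟩
  · refine (contDiff_equivalenceMap (inverseParameters ε)).contDiffOn.congr fun y hy => ?_
    have h := hΦ (Φ.map_target hy)
    rw [Φ.right_inv hy] at h
    nth_rw 2 [h]
    rw [equivalenceMap_inverse_left hε]
  · intro z hz
    have hlift := liftPoint_quadratic z 1 0 0 0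
    have hd : HasFDerivAt Φ (equivalenceDeriv ε)
        (liftPoint (quadratic (z 3) 1 0 (z 2)) (quadratic (z 4) 0 0 (z 2)) ![z 0, z 1, z 2]) := by
      rw [hlift]
      exact (hasFDerivAt_equivalenceMap ε z).congr_of_eventuallyEq
        (eventually_of_mem (Φ.open_source.mem_nhds hz) hΦ)
    -- Slope one makes `D` nonconstant. The Jacobian is `ε₄³ ε₅ ε₆` for all slopes.
    refine ⟨quadratic (z 3) 1 0 (z 2), quadratic (z 4) 0 0 (z 2), ![z 0, z 1, z 2],
      isArbitraryElementAt_quadratic (hsub hz) one_ne_zero _ _ _ _ _, hlift, ?_⟩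
    rw [nonsingularAt_inducedMap_iff hd (hasDerivAt_quadratic _ _ _ _ _)
      (hasDerivAt_quadratic _ _ _ _ _)]
    simp [inducedJacobian, equivalenceDeriv, h3, h4, h5]
  · intro D K q₀ hel hmem _
    have hcont {q : BaseSpace} (hD : ContDiffAt ℝ ∞ D (q 2)) (hK : ContDiffAt ℝ ∞ K (q 2)) :
        ContinuousAt (liftPoint D K) q :=
      (hasFDerivAt_liftPoint (hD.differentiableAt (by simp)).hasDerivAt
        (hK.differentiableAt (by simp)).hasDerivAt).continuousAt
    have hind {q : BaseSpace} (hq : liftPoint D K q ∈ Φ.source) :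
        inducedMap Φ D K q = ![q 0 * ε 3 ^ 2 * ε 4 + ε 0, q 1 * ε 3 + ε 6 * q 0 + ε 1,
          q 2 * ε 5 + ε 2] := by
      rw [inducedMap, hΦ hq]
      rfl
    have hu : Tendsto (fun q : BaseSpace => q 2) (𝓝 q₀) (𝓝 (q₀ 2)) :=
      (continuous_apply 2).continuousAt
    have hsrc {q : BaseSpace} (hD : ContDiffAt ℝ ∞ D (q 2)) (hK : ContDiffAt ℝ ∞ K (q 2))
        (hq : liftPoint D K q ∈ Φ.source) : ∀ᶠ y in 𝓝 q, liftPoint D K y ∈ Φ.source :=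
      (hcont hD hK).eventually_mem (Φ.open_source.mem_nhds hq)
    refine ⟨transformedD ε D, transformedK ε K, ?_, ?_⟩
    · rw [hind hmem]
      exact hel.transformed hε
    · filter_upwards [hu.eventually hel.smooth_D, hu.eventually hel.smooth_K,
        hsrc hel.smooth_D.self_of_nhds hel.smooth_K.self_of_nhds hmem] with q hD hK hq
      refine ⟨?_, ?_, carriesEquationAt_of_eventuallyEq hε
        ((hsrc hD hK hq).mono fun y hy => hind hy) (hD.differentiableAt (by simp))⟩
      · rw [hind hq, hΦ hq]
        simp [equivalenceMap, transformedD, liftPoint, h5]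
      · rw [hind hq, hΦ hq]
        simp [equivalenceMap, transformedK, liftPoint, h5]

/-! ### The equivalence algebra -/

/-- The linear combination of the basis operators with the coefficients `c`. -/
def equivalenceField (c : Fin 7 → ℝ) (z : ExtSpace) : ExtSpace :=
  ![(2 * c 5 + c 6) * z 0 + c 0,
    c 5 * z 1 + c 4 * z 0 + c 1,
    c 3 * z 2 + c 2,
    -c 6 * z 3,
    -(c 5 + c 6) * z 4 - c 4]

theorem mem_equivalenceSpan_iff {W : ExtSpace → ExtSpace} :
    W ∈ equivalenceSpan ↔ ∃ c, W = equivalenceField c := by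
  constructor
  · intro hW
    induction hW using Submodule.span_induction with
    | mem W hW =>
      rcases hW with rfl | rfl | rfl | rfl | rfl | rfl | rfl
      · exact ⟨![1, 0, 0, 0, 0, 0, 0], by
          funext z i; fin_cases i <;> simp [equivalenceField]⟩
      · exact ⟨![0, 1, 0, 0, 0, 0, 0], by
          funext z i; fin_cases i <;> simp [equivalenceField]⟩
      · exact ⟨![0, 0, 1, 0, 0, 0, 0], by
          funext z i; fin_cases i <;> simp [equivalenceField]⟩
      · exact ⟨![0, 0, 0, 1, 0, 0, 0], by
          funext z i; fin_cases i <;> simp [equivalenceField]⟩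
      · exact ⟨![0, 0, 0, 0, 1, 0, 0], by
          funext z i; fin_cases i <;> simp [equivalenceField]⟩
      · exact ⟨![0, 0, 0, 0, 0, 1, 0], by
          funext z i; fin_cases i <;> simp [equivalenceField]⟩
      · exact ⟨![0, 0, 0, 0, 0, 0, 1], by
          funext z i; fin_cases i <;> simp [equivalenceField]⟩
    | zero => exact ⟨0, by funext z i; fin_cases i <;> simp [equivalenceField]⟩
    | add W₁ W₂ _ _ h₁ h₂ =>
      obtain ⟨c₁, rfl⟩ := h₁
      obtain ⟨c₂, rfl⟩ := h₂
      exact ⟨c₁ + c₂, by funext z i; fin_cases i <;> simp [equivalenceField] <;> ring⟩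
    | smul k W _ h =>
      obtain ⟨c, rfl⟩ := h
      exact ⟨k • c, by funext z i; fin_cases i <;> simp [equivalenceField] <;> ring⟩
  · rintro ⟨c, rfl⟩
    have h : equivalenceField c = c 0 • (fun _ => ![1, 0, 0, 0, 0]) +
        c 1 • (fun _ => ![0, 1, 0, 0, 0]) + c 2 • (fun _ => ![0, 0, 1, 0, 0]) +
        c 3 • (fun z => ![0, 0, z 2, 0, 0]) + c 4 • (fun z => ![0, z 0, 0, 0, -1]) +
        c 5 • (fun z => ![2 * z 0, z 1, 0, 0, -z 4]) +
        c 6 • (fun z => ![z 0, 0, 0, -z 3, -z 4]) := by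
      funext z i; fin_cases i <;> simp [equivalenceField] <;> ring
    rw [h]
    repeat' apply Submodule.add_mem
    all_goals exact Submodule.smul_mem _ _ (Submodule.subset_span (by simp))

theorem analyticOnNhd_equivalenceField (c : Fin 7 → ℝ) :
    AnalyticOnNhd ℝ (equivalenceField c) univ := by
  rw [← contDiff_omega_iff_analyticOnNhd, contDiff_pi]
  intro i
  fin_cases i <;> simp [equivalenceField] <;> fun_prop

theorem contDiff_equivalenceField (c : Fin 7 → ℝ) : ContDiff ℝ ∞ (equivalenceField c) := by
  rw [contDiff_pi]
  intro i
  fin_cases i <;> simp [equivalenceField] <;> fun_prop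

/-- A one-parameter family of transformations starting at the identity has an infinitesimal
generator in the span. -/
theorem exists_equivalenceField_of_family {F : ℝ → ExtSpace → ExtSpace} {V : ExtSpace → ExtSpace}
    {z₀ : ExtSpace} {ρ : ℝ} (hρ : 0 < ρ) (hz₀ : z₀ 3 ≠ 0)
    (hF0 : ∀ z ∈ Metric.ball z₀ ρ, F 0 z = z)
    (hFd : ∀ z ∈ Metric.ball z₀ ρ, HasDerivAt (fun s => F s z) (V z) 0)
    (hF : ∀ᶠ s in 𝓝 (0 : ℝ), ∃ ε : Fin 7 → ℝ, ε 3 * ε 4 * ε 5 ≠ 0 ∧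
      EqOn (F s) (equivalenceMap ε) (Metric.ball z₀ ρ)) :
    ∃ c, EqOn V (equivalenceField c) (Metric.ball z₀ ρ) := by
  have hmem : z₀ ∈ Metric.ball z₀ ρ := Metric.mem_ball_self hρ
  have hFd' (z : ExtSpace) (hz : z ∈ Metric.ball z₀ ρ) (i : Fin 5) :
      HasDerivAt (fun s => F s z i) (V z i) 0 := hasDerivAt_pi.1 (hFd z hz) i
  set h := ρ / 2 with hh
  have hh0 : h ≠ 0 := by positivity
  have hshift (j : Fin 5) : z₀ + Pi.single j h ∈ Metric.ball z₀ ρ := by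
    rw [Metric.mem_ball, dist_self_add_left, Pi.norm_single, Real.norm_eq_abs,
      abs_of_pos (by positivity)]
    linarith
  have hquot (j i : Fin 5) := ((hFd' _ (hshift j) i).sub (hFd' _ hmem i)).div_const h
  -- The parameters are chosen separately for each `s`, without any regularity. They are
  -- differentiable at zero because differences of components of `F s` at shifted points express
  -- them; `ε₅` is reached through its inverse.
  obtain ⟨ε, hε⟩ : ∃ ε : ℝ → Fin 7 → ℝ, ∀ᶠ s in 𝓝 (0 : ℝ), ε s 3 * ε s 4 * ε s 5 ≠ 0 ∧
      EqOn (F s) (equivalenceMap (ε s)) (Metric.ball z₀ ρ) := hF.choice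
  have hid : EqOn (fun z => z) (equivalenceMap (ε 0)) (Metric.ball z₀ ρ) := fun z hz =>
    (hF0 z hz).symm.trans (hε.self_of_nhds.2 hz)
  have hA := (hquot 0 0).congr_of_eventuallyEq (f₁ := fun s => ε s 3 ^ 2 * ε s 4)
    (hε.mono fun s hs => by
      simp [hs.2 (hshift 0), hs.2 hmem, equivalenceMap]; field_simp; ring)
  have h3 := (hquot 1 1).congr_of_eventuallyEq (f₁ := fun s => ε s 3)
    (hε.mono fun s hs => by
      simp [hs.2 (hshift 1), hs.2 hmem, equivalenceMap]; field_simp; ring)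
  have h6 := (hquot 0 1).congr_of_eventuallyEq (f₁ := fun s => ε s 6)
    (hε.mono fun s hs => by
      simp [hs.2 (hshift 0), hs.2 hmem, equivalenceMap]; field_simp; ring)
  have h5 := (hquot 2 2).congr_of_eventuallyEq (f₁ := fun s => ε s 5)
    (hε.mono fun s hs => by
      simp [hs.2 (hshift 2), hs.2 hmem, equivalenceMap]; field_simp; ring)
  have h4 := ((hFd' _ hmem 3).div_const (z₀ 3)).congr_of_eventuallyEq (f₁ := fun s => (ε s 4)⁻¹)
    (hε.mono fun s hs => by
      simp [hs.2 hmem, equivalenceMap]; field_simp)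
  generalize (V (z₀ + Pi.single 0 h) 0 - V z₀ 0) / h = α at hA
  generalize (V (z₀ + Pi.single 1 h) 1 - V z₀ 1) / h = β at h3
  generalize (V (z₀ + Pi.single 0 h) 1 - V z₀ 1) / h = γ at h6
  generalize (V (z₀ + Pi.single 2 h) 2 - V z₀ 2) / h = μ at h5
  generalize V z₀ 3 / z₀ 3 = ν at h4
  have e3 : ε 0 3 = 1 := by
    have h1 := congrFun (hid (hshift 1)) 1
    have h2 := congrFun (hid hmem) 1
    simp [equivalenceMap] at h1 h2
    refine mul_left_cancel₀ hh0 ?_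
    linear_combination h2 - h1
  have e6 : ε 0 6 = 0 := by
    have h1 := congrFun (hid (hshift 0)) 1
    have h2 := congrFun (hid hmem) 1
    simp [equivalenceMap] at h1 h2
    refine mul_left_cancel₀ hh0 ?_
    linear_combination h2 - h1
  have e4 : ε 0 4 = 1 := by
    have h1 := congrFun (hid hmem) 3
    simp [equivalenceMap] at h1
    have : z₀ 3 * (ε 0 4)⁻¹ = z₀ 3 * 1 := by linear_combination -h1
    simpa using mul_left_cancel₀ hz₀ this
  -- The derivative at `s = 0` of the identity `(ε₄² ε₅) ε₅⁻¹ = ε₄²`: the scalings of `t`, `x` and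
  -- `D` are not independent.
  have hαβ : α + ν = 2 * β := by
    have h1 := hA.mul h4
    have h2 := (h3.pow 2).congr_of_eventuallyEq
      (f₁ := (fun s => ε s 3 ^ 2 * ε s 4) * fun s => (ε s 4)⁻¹) (hε.mono fun s hs => by
        have := right_ne_zero_of_mul (left_ne_zero_of_mul hs.1)
        simp; field_simp)
    simpa [e3, e4] using h1.unique h2
  refine ⟨![V z₀ 0 - α * z₀ 0, V z₀ 1 - (β * z₀ 1 + γ * z₀ 0), V z₀ 2 - μ * z₀ 2, μ, γ, β, -ν],
    fun z hz => ?_⟩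
  have v0 : V z 0 - V z₀ 0 = α * (z 0 - z₀ 0) := by
    refine ((hFd' z hz 0).sub (hFd' z₀ hmem 0)).unique ((hA.mul_const _).congr_of_eventuallyEq
      (hε.mono fun s hs => ?_))
    simp [hs.2 hz, hs.2 hmem, equivalenceMap]; ring
  have v1 : V z 1 - V z₀ 1 = β * (z 1 - z₀ 1) + γ * (z 0 - z₀ 0) := by
    refine ((hFd' z hz 1).sub (hFd' z₀ hmem 1)).unique
      (((h3.mul_const _).add (h6.mul_const _)).congr_of_eventuallyEq (hε.mono fun s hs => ?_))
    simp [hs.2 hz, hs.2 hmem, equivalenceMap]; ring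
  have v2 : V z 2 - V z₀ 2 = μ * (z 2 - z₀ 2) := by
    refine ((hFd' z hz 2).sub (hFd' z₀ hmem 2)).unique ((h5.mul_const _).congr_of_eventuallyEq
      (hε.mono fun s hs => ?_))
    simp [hs.2 hz, hs.2 hmem, equivalenceMap]; ring
  have v3 : V z 3 = z 3 * ν := by
    refine (hFd' z hz 3).unique ((h4.const_mul _).congr_of_eventuallyEq (hε.mono fun s hs => ?_))
    simp [hs.2 hz, equivalenceMap]
  have v4 : V z 4 = -(β - ν) * z 4 - γ := by
    have hi := h3.inv (by simp [e3])
    have hk := (((hi.const_mul (z 4)).mul h4).sub ((h6.mul (hi.pow 2)).mul h4))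
    refine ((hFd' z hz 4).unique (hk.congr_of_eventuallyEq (hε.mono fun s hs => ?_))).trans ?_
    · simp [hs.2 hz, equivalenceMap]
    · simp [e3, e4, e6]; ring
  ext i
  fin_cases i
  · simp [equivalenceField]; linear_combination v0 + z 0 * hαβ
  · simp [equivalenceField]; linear_combination v1
  · simp [equivalenceField]; linear_combination v2
  · simp [equivalenceField]; linear_combination v3
  · simp [equivalenceField]; linear_combination v4

/-- For each small time the flow map on a ball, which is connected, is a single member of the
family, so the generator is locally in the span. The identity principle for the analytic fields of
the span then makes the coefficients global. -/
theorem IsEquivalenceOperatorOn.exists_eqOn {Ω : Set ExtSpace} (hΩ' : IsPreconnected Ω)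
    (hsub : Ω ⊆ diffusiveRegion) {V : ExtSpace → ExtSpace} (h : IsEquivalenceOperatorOn Ω V) :
    ∃ c, EqOn V (equivalenceField c) Ω := by
  rcases Ω.eq_empty_or_nonempty with rfl | hne
  · exact ⟨0, eqOn_empty _ _⟩
  -- No side condition on the coefficients is needed, so the predicate in the identity principle is
  -- `True`.
  suffices ∃ c, True ∧ EqOn V (equivalenceField c) Ω by simpa using this
  refine exists_eqOn_of_locally_analytic hΩ' hne analyticOnNhd_equivalenceField fun z₀ hz₀ => ?_
  obtain ⟨δ, hδ, N, hN, hzN, F, hF0, hF, hΦ⟩ := h.flow z₀ hz₀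
  obtain ⟨ρ, hρ, hball⟩ := Metric.isOpen_iff.1 hN z₀ hzN
  have h0 : (0 : ℝ) ∈ Ioo (-δ) δ := ⟨by linarith, hδ⟩
  obtain ⟨c, hc⟩ := exists_equivalenceField_of_family (F := F) (V := V) hρ (hsub hz₀)
    (fun z hz => hF0 z (hball hz))
    (fun z hz => by simpa [hF0 z (hball hz)] using (hF 0 h0 z (hball hz)).2)
    (eventually_of_mem (Ioo_mem_nhds h0.1 h0.2) fun s hs => by
      obtain ⟨Φ, hΦe, hΦs, hΦF⟩ := hΦ s hs
      obtain ⟨ε, hε, hεΦ⟩ := hΦe.exists_eqOn_equivalenceMap (convex_ball z₀ ρ).isPreconnected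
        (by rwa [hΦs])
      exact ⟨ε, hε, (hΦF.mono hball).symm.trans hεΦ⟩)
  exact ⟨c, trivial, eventually_of_mem (Metric.ball_mem_nhds z₀ hρ) hc⟩

/-- Variation of constants. -/
theorem exists_hasDerivAt_linear (m : ℝ) {g : ℝ → ℝ} (hg : Continuous g) :
    ∃ y : ℝ → ℝ, y 0 = 0 ∧ ∀ s, HasDerivAt y (m * y s + g s) s := by
  have hexp (m s : ℝ) : HasDerivAt (fun s => Real.exp (m * s)) (Real.exp (m * s) * m) s := by
    simpa using ((hasDerivAt_id s).const_mul m).exp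
  refine ⟨fun s => Real.exp (m * s) * ∫ r in (0 : ℝ)..s, Real.exp (-m * r) * g r, by simp,
    fun s => ?_⟩
  have hprim : HasDerivAt (fun s => ∫ r in (0 : ℝ)..s, Real.exp (-m * r) * g r)
      (Real.exp (-m * s) * g s) s :=
    (by fun_prop : Continuous fun r => Real.exp (-m * r) * g r).integral_hasStrictDerivAt 0 s
      |>.hasDerivAt
  refine ((hexp m s).mul hprim).congr_deriv ?_
  have h : Real.exp (m * s) * Real.exp (-m * s) = 1 := by rw [← Real.exp_add]; simp
  linear_combination g s * h

/-- Every field in the span has a flow consisting of transformations `equivalenceMap`. -/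
theorem exists_flow_equivalenceField (c : Fin 7 → ℝ) :
    ∃ ε : ℝ → Fin 7 → ℝ, (∀ i, Continuous fun s => ε s i) ∧
      (∀ s, ε s 3 ≠ 0 ∧ ε s 4 ≠ 0 ∧ ε s 5 ≠ 0) ∧ (∀ z, equivalenceMap (ε 0) z = z) ∧
      ∀ s z, HasDerivAt (fun s => equivalenceMap (ε s) z)
        (equivalenceField c (equivalenceMap (ε s) z)) s := by
  have hexp (m s : ℝ) : HasDerivAt (fun s => Real.exp (m * s)) (Real.exp (m * s) * m) s := by
    simpa using ((hasDerivAt_id s).const_mul m).exp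
  -- The linear system of the flow is triangular: the shift of `t` drives the shift of `x`, and the
  -- scaling of `t` drives the coefficient `e₆` of `t` in the new `x`.
  obtain ⟨e₀, h₀, h₀'⟩ := exists_hasDerivAt_linear (2 * c 5 + c 6)
    (continuous_const (y := c 0))
  have hc₀ : Continuous e₀ := continuous_iff_continuousAt.2 fun s => (h₀' s).continuousAt
  obtain ⟨e₁, h₁, h₁'⟩ := exists_hasDerivAt_linear (c 5)
    (by fun_prop : Continuous fun s => c 4 * e₀ s + c 1)
  obtain ⟨e₂, h₂, h₂'⟩ := exists_hasDerivAt_linear (c 3) (continuous_const (y := c 2))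
  obtain ⟨e₆, h₆, h₆'⟩ := exists_hasDerivAt_linear (c 5)
    (by fun_prop : Continuous fun s => c 4 * Real.exp ((2 * c 5 + c 6) * s))
  have hc₁ : Continuous e₁ := continuous_iff_continuousAt.2 fun s => (h₁' s).continuousAt
  have hc₂ : Continuous e₂ := continuous_iff_continuousAt.2 fun s => (h₂' s).continuousAt
  have hc₆ : Continuous e₆ := continuous_iff_continuousAt.2 fun s => (h₆' s).continuousAt
  let ε : ℝ → Fin 7 → ℝ := fun s => ![e₀ s, e₁ s, e₂ s, Real.exp (c 5 * s), Real.exp (c 6 * s),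
    Real.exp (c 3 * s), e₆ s]
  have hα (s : ℝ) : Real.exp (c 5 * s) ^ 2 * Real.exp (c 6 * s) =
      Real.exp ((2 * c 5 + c 6) * s) := by
    rw [← Real.exp_nat_mul, ← Real.exp_add]; congr 1; push_cast; ring
  have hmap (s : ℝ) (z : ExtSpace) : equivalenceMap (ε s) z =
      ![z 0 * Real.exp ((2 * c 5 + c 6) * s) + e₀ s, z 1 * Real.exp (c 5 * s) + e₆ s * z 0 + e₁ s,
        z 2 * Real.exp (c 3 * s) + e₂ s, z 3 * Real.exp (-c 6 * s),
        z 4 * Real.exp (-(c 5 + c 6) * s) - e₆ s * Real.exp (-(2 * c 5 + c 6) * s)] := by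
    have h6 : (Real.exp (c 6 * s))⁻¹ = Real.exp (-c 6 * s) := by rw [← Real.exp_neg]; ring_nf
    have h56 : (Real.exp (c 5 * s))⁻¹ * (Real.exp (c 6 * s))⁻¹ = Real.exp (-(c 5 + c 6) * s) := by
      rw [← Real.exp_neg, ← Real.exp_neg, ← Real.exp_add]; ring_nf
    have hα' : (Real.exp (c 5 * s) ^ 2)⁻¹ * (Real.exp (c 6 * s))⁻¹ =
        Real.exp (-(2 * c 5 + c 6) * s) := by
      rw [← mul_inv, hα, ← Real.exp_neg]; ring_nf
    ext i
    fin_cases i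
    · simp [equivalenceMap, ε, mul_assoc, hα]
    · simp [equivalenceMap, ε]
    · simp [equivalenceMap, ε]
    · simp [equivalenceMap, ε, h6]
    · simp [equivalenceMap, ε, mul_assoc, h56, hα']
  refine ⟨ε, fun i => ?_, fun s => ?_, fun z => ?_, fun s z => ?_⟩
  · fin_cases i <;> simp [ε] <;> fun_prop
  · simp [ε, Real.exp_ne_zero]
  · rw [hmap]
    ext i
    fin_cases i <;> simp [h₀, h₁, h₂, h₆]
  · simp only [hmap]
    refine hasDerivAt_pi.2 fun i => ?_
    fin_cases i
    · exact (((hexp _ s).const_mul (z 0)).add (h₀' s)).congr_deriv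
        (by simp [equivalenceField]; ring)
    · exact ((((hexp _ s).const_mul (z 1)).add ((h₆' s).mul_const (z 0))).add (h₁' s)).congr_deriv
        (by simp [equivalenceField]; ring)
    · exact (((hexp _ s).const_mul (z 2)).add (h₂' s)).congr_deriv
        (by simp [equivalenceField]; ring)
    · exact ((hexp _ s).const_mul (z 3)).congr_deriv (by simp [equivalenceField]; ring)
    · have h : Real.exp ((2 * c 5 + c 6) * s) * Real.exp (-(2 * c 5 + c 6) * s) = 1 := by
        rw [← Real.exp_add, ← add_mul, add_neg_cancel, zero_mul, Real.exp_zero]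
      refine (((hexp _ s).const_mul (z 4)).sub ((h₆' s).mul (hexp _ s))).congr_deriv ?_
      simp only [equivalenceField, Fin.reduceFinMk, Matrix.cons_val]
      linear_combination -c 4 * h

theorem isEquivalenceOperatorOn_of_eqOn {Ω : Set ExtSpace} (hΩ : IsOpen Ω)
    (hsub : Ω ⊆ diffusiveRegion) {V : ExtSpace → ExtSpace} {c : Fin 7 → ℝ}
    (hV : EqOn V (equivalenceField c) Ω) : IsEquivalenceOperatorOn Ω V := by
  refine ⟨(contDiff_equivalenceField c).contDiffOn.congr hV, fun z₀ hz₀ => ?_⟩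
  obtain ⟨ε, hεc, hε, hid, hflow⟩ := exists_flow_equivalenceField c
  have hcont : Continuous fun p : ℝ × ExtSpace => equivalenceMap (ε p.1) p.2 := by
    have h (i : Fin 7) : Continuous fun p : ℝ × ExtSpace => ε p.1 i := (hεc i).comp continuous_fst
    have h3 : Continuous fun p : ℝ × ExtSpace => (ε p.1 3)⁻¹ := (h 3).inv₀ fun p => (hε p.1).1
    have h3' : Continuous fun p : ℝ × ExtSpace => (ε p.1 3 ^ 2)⁻¹ :=
      ((h 3).pow 2).inv₀ fun p => pow_ne_zero 2 (hε p.1).1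
    have h4 : Continuous fun p : ℝ × ExtSpace => (ε p.1 4)⁻¹ := (h 4).inv₀ fun p => (hε p.1).2.1
    refine continuous_pi fun i => ?_
    fin_cases i <;> simp only [equivalenceMap, Fin.reduceFinMk, Matrix.cons_val] <;> fun_prop
  have hev : ∀ᶠ p : ℝ × ExtSpace in 𝓝 (0, z₀), equivalenceMap (ε p.1) p.2 ∈ Ω :=
    hcont.continuousAt.eventually_mem (by rw [hid]; exact hΩ.mem_nhds hz₀)
  obtain ⟨δ, hδ, hball⟩ := Metric.eventually_nhds_iff_ball.1 hev
  have hmem {s : ℝ} {z : ExtSpace} (hs : s ∈ Ioo (-δ) δ) (hz : z ∈ Metric.ball z₀ δ) :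
      equivalenceMap (ε s) z ∈ Ω := by
    refine hball (s, z) ?_
    rw [← ball_prod_same]
    exact ⟨by rwa [Real.ball_eq_Ioo, zero_sub, zero_add], hz⟩
  refine ⟨δ, hδ, Metric.ball z₀ δ, Metric.isOpen_ball, Metric.mem_ball_self hδ,
    fun s => equivalenceMap (ε s), fun z _ => hid z, fun s hs z hz => ⟨hmem hs hz, ?_⟩,
    fun s hs => ?_⟩
  · rw [hV (hmem hs hz)]
    exact hflow s z
  · have hε' : ε s 3 * ε s 4 * ε s 5 ≠ 0 :=
      mul_ne_zero (mul_ne_zero (hε s).1 (hε s).2.1) (hε s).2.2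
    let Φ := (equivalenceHomeomorph (ε s) hε').toOpenPartialHomeomorph.restrOpen
      (Metric.ball z₀ δ) Metric.isOpen_ball
    have hsrc : Φ.source = Metric.ball z₀ δ := by simp [Φ]
    refine ⟨Φ, isEquivalenceTransformation_of_eqOn ?_ hε' fun _ _ => rfl, hsrc, fun _ _ => rfl⟩
    rw [hsrc]
    intro z hz
    refine hsub ?_
    -- At time zero the flow is the identity, so the ball itself lies in `Ω`.
    simpa [hid] using hmem (s := 0) ⟨by linarith, hδ⟩ hz

theorem theorem6 :
    (∀ Ω : Set ExtSpace, IsOpen Ω → IsPreconnected Ω → Ω ⊆ diffusiveRegion →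
      ∀ V : ExtSpace → ExtSpace,
        IsEquivalenceOperatorOn Ω V ↔ ∃ W ∈ equivalenceSpan, EqOn V W Ω) ∧
    (∀ Φ : OpenPartialHomeomorph ExtSpace ExtSpace,
      IsPreconnected Φ.source → Φ.source ⊆ diffusiveRegion →
        (IsEquivalenceTransformation Φ ↔
          ∃ ε₁ ε₂ ε₃ ε₄ ε₅ ε₆ ε₇ : ℝ, ε₄ * ε₅ * ε₆ ≠ 0 ∧
            ∀ z ∈ Φ.source, Φ z =
              ![z 0 * ε₄ ^ 2 * ε₅ + ε₁,
                z 1 * ε₄ + ε₇ * z 0 + ε₂,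
                z 2 * ε₆ + ε₃,
                z 3 * ε₅⁻¹,
                z 4 * ε₄⁻¹ * ε₅⁻¹ - ε₇ * (ε₄ ^ 2)⁻¹ * ε₅⁻¹])) := by
  refine ⟨fun Ω hΩ hΩ' hsub V => ⟨fun h => ?_, ?_⟩, fun Φ hpre hsub => ⟨fun h => ?_, ?_⟩⟩
  · obtain ⟨c, hc⟩ := h.exists_eqOn hΩ' hsub
    exact ⟨equivalenceField c, mem_equivalenceSpan_iff.2 ⟨c, rfl⟩, hc⟩
  · rintro ⟨W, hW, hVW⟩
    obtain ⟨c, rfl⟩ := mem_equivalenceSpan_iff.1 hW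
    exact isEquivalenceOperatorOn_of_eqOn hΩ hsub hVW
  · obtain ⟨ε, hε, hΦ⟩ := h.exists_eqOn_equivalenceMap hpre subset_rfl
    exact ⟨ε 0, ε 1, ε 2, ε 3, ε 4, ε 5, ε 6, hε, hΦ⟩
  · rintro ⟨ε₁, ε₂, ε₃, ε₄, ε₅, ε₆, ε₇, hε, hΦ⟩
    exact isEquivalenceTransformation_of_eqOn hsub (ε := ![ε₁, ε₂, ε₃, ε₄, ε₅, ε₆, ε₇]) hε hΦ
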